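/- Fix $p\in(0,1)$ and $\zeta\in[0,1]$. An instance is a pair $(n,F)$, where $n\ge 1$ and $F\in\mathcal F$, the set of distribution functions of finite mean, supported in $[0,\infty)$, that are continuous and strictly increasing on their support. The values $X_1,\dots,X_n$ are i.i.d. with distribution $F$, and the disruption indicators $Y_1,\dots,Y_n$ are i.i.d. Bernoulli with parameter $p$, independent of the values. A decision maker observes $X_1,\dots,X_n$ in this order. Each value is irrevocably selected or skipped when it is observed, before $Y_i$ is known. If $X_i$ is selected and $Y_i=0$, the decision maker receives $X_i$ and the process continues; if $X_i$ is selected and $Y_i=1$, the decision maker receives $\zeta X_i$ and the process stops. An adaptive threshold algorithm chooses for each instance $(n,F)$ a (possibly random, drawn independently of the $X_i$ and $Y_i$) sequence $\tau_1\ge\cdots\ge\tau_n$ and, as long as the process has not stopped, selects $X_i$ if and only if $X_i\ge\tau_i$; $v(\mathtt{ALG})$ is its expected total reward. The clairvoyant benchmark is $$v(\mathtt{OPT})=\mathbb E\Big[\max_{\sigma}\Big\{\sum_{i=1}^{\min\{D-1,n\}}X_{\sigma(i)}+\zeta\,\mathbb 1\{D\le n\}\,X_{\sigma(D)}\Big\}\Big],$$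 where $\sigma$ ranges over the permutations of $\{1,\dots,n\}$ and $D$ is independent of the values with $\Pr[D=j]=p(1-p)^{j-1}$ for $j\ge1$. Put $$\gamma^{\mathrm{AD}}_{n,p,\zeta}=\sup_{\mathtt{ALG}}\inf_{F\in\mathcal F}\frac{v(\mathtt{ALG}(n,F))}{v(\mathtt{OPT}(n,F))},\qquad \gamma^{\mathrm{AD}}_{p,\zeta}=\sup_{\mathtt{ALG}}\inf_{n\ge1,\,F\in\mathcal F}\frac{v(\mathtt{ALG}(n,F))}{v(\mathtt{OPT}(n,F))},$$ where the suprema are over all adaptive threshold algorithms. **Theorem 3.** There is exactly one $\theta^*\in(0,1)$ such that $\beta=1/\theta^*$ solves $\int_0^1\big(y-y\ln y+(\beta-1)\big)^{-1}\,\mathrm dy=1$. For every $p\in(0,1)$ and $\zeta\in[0,1]$, we have $\gamma^{\mathrm{AD}}_{p,\zeta}\le\theta^*$, and moreover $\lim_{n\to\infty}\gamma^{\mathrm{AD}}_{n,p,\zeta}=\theta^*$. -/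

import Mathlib

open MeasureTheory ProbabilityTheory Filter Topology

/-- The class of admissible value distributions: laws on the non-negative reals, of finite mean,
whose cumulative distribution function is continuous and strictly increasing on its support
(that is, wherever it lies strictly between `0` and `1`). -/
structure ValueLaw where
  /-- the law of one value `X i` -/
  law : Measure ℝ
  isProbabilityMeasure : IsProbabilityMeasure law
  nonneg : law (Set.Iio 0) = 0
  finite_mean : Integrable (fun x : ℝ => x) law
  continuous_cdf : Continuous (fun x : ℝ => cdf law x)
  strictMonoOn_cdf :
    StrictMonoOn (fun x : ℝ => cdf law x) {x : ℝ | 0 < cdf law x ∧ cdf law x < 1}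

/-- The total reward of the decision maker who uses the thresholds `τ 0, …, τ (n - 1)`, when the
observed values are `x` and the disruption indicators are `y`: the value `x i` is selected if it is
at least `τ i` and no earlier selection has caused a disruption; a selected value pays `x i`, or
only `ζ * x i` if its selection causes a disruption, after which the process stops. -/
noncomputable def onlineReward (ζ : ℝ) {n : ℕ} (τ x : Fin n → ℝ) (y : Fin n → Bool) : ℝ :=
  ∑ i : Fin n,
    if τ i ≤ x i ∧ ∀ j : Fin n, j < i → ¬ (τ j ≤ x j ∧ y j = true) then
      (if y i = true then ζ * x i else x i)
    else 0

/-- The expected reward of the thresholds `τ` when the values are i.i.d. with law `F` and the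
disruption indicators are i.i.d. Bernoulli with parameter `p`, independent of the values. -/
noncomputable def thresholdValue (p : unitInterval) (ζ : ℝ) (F : ValueLaw) {n : ℕ}
    (τ : Fin n → ℝ) : ℝ :=
  ∫ z : (Fin n → ℝ) × (Fin n → Bool), onlineReward ζ τ z.1 z.2
    ∂((Measure.pi fun _ : Fin n => F.law).prod
      (Measure.pi fun _ : Fin n => bernoulliMeasure true false p))

/-- An adaptive threshold algorithm: for every instance `(n, F)` a (possibly randomized) choice of
a non-increasing sequence of thresholds, given by the law of that sequence. Deterministic
thresholds are Dirac measures. -/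
structure AdaptiveAlgorithm where
  /-- the law of the threshold sequence used on the instance `(n, F)` -/
  thresholds : (n : ℕ) → ValueLaw → Measure (Fin n → ℝ)
  isProbabilityMeasure : ∀ n F, IsProbabilityMeasure (thresholds n F)
  antitone : ∀ n F, ∀ᵐ τ ∂(thresholds n F), Antitone τ

/-- The expected value `v(ALG)` of an adaptive threshold algorithm on the instance `(n, F)`; the
thresholds are drawn independently of the values and of the disruptions. -/
noncomputable def algValue (p : unitInterval) (ζ : ℝ) (A : AdaptiveAlgorithm) (n : ℕ)
    (F : ValueLaw) : ℝ :=
  ∫ τ, thresholdValue p ζ F τ ∂(A.thresholds n F)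

/-- The reward collected when the values `x` are selected in the order `σ` and the first disruption
happens at the selection number `D` (counted from `1`): the first `min (D - 1) n` values in full,
and the fraction `ζ` of the value number `D` if `D ≤ n`. -/
noncomputable def clairvoyantReward (ζ : ℝ) {n : ℕ} (x : Fin n → ℝ) (σ : Equiv.Perm (Fin n))
    (D : ℕ) : ℝ :=
  ∑ i : Fin n,
    if (i : ℕ) + 1 < D then x (σ i) else if (i : ℕ) + 1 = D then ζ * x (σ i) else 0

/-- The expected value `v(OPT)` of the optimal clairvoyant algorithm on the instance `(n, F)`. Here
`D = g + 1`, where `g` (the number of failures before the first success) has the geometric law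
with success probability `p`, so that `D = j` has probability `p * (1 - p) ^ (j - 1)`. -/
noncomputable def optValue (p : unitInterval) (ζ : ℝ) (n : ℕ) (F : ValueLaw) : ℝ :=
  ∫ z : (Fin n → ℝ) × ℕ, (⨆ σ : Equiv.Perm (Fin n), clairvoyantReward ζ z.1 σ (z.2 + 1))
    ∂((Measure.pi fun _ : Fin n => F.law).prod (geometricMeasure p))

/-- The competitive ratio of the class of adaptive threshold algorithms for instances of
length `n`. -/
noncomputable def gammaLength (n : ℕ) (p : unitInterval) (ζ : ℝ) : ℝ :=
  ⨆ A : AdaptiveAlgorithm, ⨅ F : ValueLaw, algValue p ζ A n F / optValue p ζ n F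

/-- The competitive ratio of the class of adaptive threshold algorithms over all instances
`(n, F)` with `n ≥ 1`. -/
noncomputable def gammaAD (p : unitInterval) (ζ : ℝ) : ℝ :=
  ⨆ A : AdaptiveAlgorithm, ⨅ I : ℕ+ × ValueLaw,
    algValue p ζ A (I.1 : ℕ) I.2 / optValue p ζ (I.1 : ℕ) I.2

/-- `θ` is the Hill–Kertz constant: `β = 1 / θ > 1` solves
`∫₀¹ (y - y ln y + (β - 1))⁻¹ dy = 1`. -/
def IsHillKertzConstant (θ : ℝ) : Prop :=
  0 < θ ∧ θ < 1 ∧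
    (∫ y in (0 : ℝ)..1, (y - y * Real.log y + (1 / θ - 1))⁻¹) = 1

-- Independence and layer cake reduce both values to the tail G of F. With r = 1 - p + ζp, the
-- online value is r times a sum of survival probability times E[X; X ≥ τ_i], and the stopping
-- probability at step i is pG(τ_i) (`thresholdValue_eq`). The benchmark is (r/p) ∫ (1 - (1 -
-- pG(t))^n) dt (`optValue_eq`). The factor r cancels in the ratio, so ζ drops out; what remains is
-- an i.i.d. prophet inequality for variables thinned by p.
--
-- Put c = β - 1, h(s) = s - s ln s + c, T(y) = ∫_0^y 1/h. The equation for β says T(1) = 1: the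
-- curve y' = -h(y) falls from 1 to 0 in unit time. T(1) is continuous and strictly decreasing in c
-- and crosses 1, so c is unique. Both bounds discretise this curve into n steps of duration 1/n.
--
-- Lower bound: stop at rate -ln y. Since h' = -ln, the survival probability is then h(y)/(1 + c).
-- In curve time the factor h is the Jacobian of y, so the reward of level s = 1 - e^{-a/n} becomes
-- θ ∫_0^1 min(-ln y, a) dy = θ(1 - e^{-a}) = θ(1 - (1 - s)^n). This holds level by level, hence for
-- every F (`exists_acceptance_probabilities`, `exists_thresholds_ge`). Truncating the rate at K
-- keeps the stopping probabilities below p once n is large; the cost vanishes as n, then K, grows.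
--
-- Upper bound: put V(y) = ∫_0^y h⁻² and N = np. The hard law has quantile function V(e^{-Nx}) plus
-- a rare huge value contributing 1/((1 + c)N) to the mean. Then N E(X - V(y))⁺ ≤ 1/h(y), which is
-- the rate at which V decreases along the curve, so V is asymptotically a supersolution of the
-- Bellman recursion and no thresholds earn more than about V(1) (`thresholdValue_le`). The
-- benchmark tends to at least ∫_0^1 V + 1/(1 + c) = (1 + c)V(1) (`integral_hillKertzValue`). The
-- ratio is θ.

attribute [instance] ValueLaw.isProbabilityMeasure

/-! ### Closed form of the online value -/

/-- The expected fraction of a selected value that is received. -/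
noncomputable def payFraction (p : unitInterval) (ζ : ℝ) : ℝ := 1 - p + ζ * p

theorem ValueLaw.integrable_tail (F : ValueLaw) (a : ℝ) :
    Integrable (fun x : ℝ => (Set.Ici a).indicator (fun _ => (1 : ℝ)) x * x) F.law := by
  have h := F.finite_mean.indicator (measurableSet_Ici (a := a))
  refine h.congr (Eventually.of_forall fun x => ?_)
  by_cases hx : x ∈ Set.Ici a <;> simp [hx]

theorem ValueLaw.integral_tail (F : ValueLaw) (a : ℝ) :
    ∫ x : ℝ, (Set.Ici a).indicator (fun _ => (1 : ℝ)) x * x ∂F.law =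
      ∫ x in Set.Ici a, x ∂F.law := by
  rw [← integral_indicator measurableSet_Ici]
  congr 1
  ext x
  by_cases hx : x ∈ Set.Ici a <;> simp [hx]

/-- The factor of the reward at step `i` that depends on the value and the disruption at
step `j`. -/
noncomputable def stepFactor (ζ : ℝ) {n : ℕ} (τ : Fin n → ℝ) (i j : Fin n) (z : ℝ × Bool) : ℝ :=
  if j < i then
    1 - (Set.Ici (τ j)).indicator (fun _ => (1 : ℝ)) z.1 * (if z.2 = true then 1 else 0)
  else if j = i then
    (Set.Ici (τ i)).indicator (fun _ => (1 : ℝ)) z.1 * z.1 * (if z.2 = true then ζ else 1)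
  else 1

/-- Survival up to step i is a product of indicators, one for each earlier step, so the reward of
step i factors over coordinates and independence can be applied to it. -/
theorem onlineReward_eq_sum_prod (ζ : ℝ) {n : ℕ} (τ x : Fin n → ℝ) (y : Fin n → Bool) :
    onlineReward ζ τ x y = ∑ i, ∏ j, stepFactor ζ τ i j (x j, y j) := by
  unfold onlineReward
  refine Finset.sum_congr rfl fun i _ => ?_
  split_ifs with h hy
  · rw [Finset.prod_eq_single i]
    · simp [stepFactor, h.1, hy, mul_comm]
    · intro j _ hj
      rcases lt_or_gt_of_ne hj with hlt | hgt
      · have := h.2 j hlt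
        by_cases h1 : τ j ≤ x j
        · have h2 : y j = false := by simpa [h1] using this
          simp [stepFactor, hlt, h2]
        · simp [stepFactor, hlt, h1]
      · simp [stepFactor, hj, hgt.not_gt]
    · simp
  · rw [Finset.prod_eq_single i]
    · simp [stepFactor, h.1, hy]
    · intro j _ hj
      rcases lt_or_gt_of_ne hj with hlt | hgt
      · have := h.2 j hlt
        by_cases h1 : τ j ≤ x j
        · have h2 : y j = false := by simpa [h1] using this
          simp [stepFactor, hlt, h2]
        · simp [stepFactor, hlt, h1]
      · simp [stepFactor, hj, hgt.not_gt]
    · simp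
  · symm
    rw [not_and_or] at h
    rcases h with h | h
    · exact Finset.prod_eq_zero (Finset.mem_univ i) (by simp [stepFactor, h])
    · push Not at h
      obtain ⟨j, hj, h1, h2⟩ := h
      exact Finset.prod_eq_zero (Finset.mem_univ j) (by simp [stepFactor, hj, h1, h2])

theorem integrable_bernoulliMeasure (p : unitInterval) (f : Bool → ℝ) :
    Integrable f (bernoulliMeasure true false p) := by
  exact Integrable.of_finite

theorem integrable_stepFactor (p : unitInterval) (ζ : ℝ) (F : ValueLaw) {n : ℕ} (τ : Fin n → ℝ)
    (i j : Fin n) :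
    Integrable (stepFactor ζ τ i j) (F.law.prod (bernoulliMeasure true false p)) := by
  unfold stepFactor
  split_ifs
  · refine (integrable_const 1).sub (Integrable.mul_prod
      (f := (Set.Ici (τ j)).indicator (fun _ => (1 : ℝ)))
      (g := fun b : Bool => if b = true then (1 : ℝ) else 0) ?_ (integrable_bernoulliMeasure p _))
    exact (integrable_const 1).indicator measurableSet_Ici
  · exact Integrable.mul_prod
      (f := fun x => (Set.Ici (τ i)).indicator (fun _ => (1 : ℝ)) x * x)
      (g := fun b : Bool => if b = true then ζ else 1) (F.integrable_tail _)
        (integrable_bernoulliMeasure p _)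
  · exact integrable_const 1

theorem integral_stepFactor (p : unitInterval) (ζ : ℝ) (F : ValueLaw) {n : ℕ} (τ : Fin n → ℝ)
    (i j : Fin n) :
    ∫ z, stepFactor ζ τ i j z ∂(F.law.prod (bernoulliMeasure true false p)) =
      if j < i then 1 - p * F.law.real (Set.Ici (τ j))
      else if j = i then payFraction p ζ * ∫ x in Set.Ici (τ i), x ∂F.law else 1 := by
  unfold stepFactor
  split_ifs
  · rw [integral_sub (integrable_const 1), integral_prod_mul
      (f := (Set.Ici (τ j)).indicator (fun _ => (1 : ℝ)))
      (g := fun b : Bool => if b = true then (1 : ℝ) else 0), integral_bernoulliMeasure,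
      integral_indicator_const _ measurableSet_Ici]
    · simp [mul_comm]
    · refine Integrable.mul_prod
        (f := (Set.Ici (τ j)).indicator (fun _ => (1 : ℝ)))
        (g := fun b : Bool => if b = true then (1 : ℝ) else 0) ?_ (integrable_bernoulliMeasure p _)
      exact (integrable_const 1).indicator measurableSet_Ici
  · rw [integral_prod_mul
      (f := fun x => (Set.Ici (τ i)).indicator (fun _ => (1 : ℝ)) x * x)
      (g := fun b : Bool => if b = true then ζ else 1), integral_bernoulliMeasure,
      F.integral_tail]
    simp [payFraction]
    ring
  · simp

theorem thresholdValue_eq (p : unitInterval) (ζ : ℝ) (F : ValueLaw) {n : ℕ} (τ : Fin n → ℝ) :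
    thresholdValue p ζ F τ = payFraction p ζ * ∑ i : Fin n,
      (∏ j ∈ Finset.univ.filter (· < i), (1 - p * F.law.real (Set.Ici (τ j)))) *
        ∫ x in Set.Ici (τ i), x ∂F.law := by
  -- Regrouping values and disruptions into pairs (x j, y j) gives a single product measure over the
  -- steps.
  have hm := measurePreserving_arrowProdEquivProdArrow ℝ Bool (Fin n) (fun _ => F.law)
    (fun _ => bernoulliMeasure true false p)
  unfold thresholdValue
  rw [← hm.integral_comp']
  have : ∀ w : Fin n → ℝ × Bool,
      onlineReward ζ τ (MeasurableEquiv.arrowProdEquivProdArrow ℝ Bool (Fin n) w).1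
        (MeasurableEquiv.arrowProdEquivProdArrow ℝ Bool (Fin n) w).2 =
      ∑ i, ∏ j, stepFactor ζ τ i j (w j) := by
    intro w
    rw [onlineReward_eq_sum_prod]
    rfl
  simp_rw [this]
  rw [integral_finsetSum _ fun i _ => Integrable.fintype_prod fun j =>
    integrable_stepFactor p ζ F τ i j, Finset.mul_sum]
  refine Finset.sum_congr rfl fun i _ => ?_
  rw [integral_fintype_prod_eq_prod]
  simp_rw [integral_stepFactor]
  rw [Finset.prod_ite, ← Finset.mul_prod_erase (Finset.univ.filter fun j => ¬ j < i) _ (a := i)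
    (by simp), Finset.prod_eq_one (s := (Finset.univ.filter fun j => ¬ j < i).erase i)]
  · rw [if_pos rfl]
    ring
  · intro j hj
    exact if_neg (Finset.ne_of_mem_erase hj)

/-! ### The clairvoyant benchmark as an integral of the tail -/

theorem geometricMeasure_real_Ioi (p : unitInterval) (hp : 0 < p) (i : ℕ) :
    (geometricMeasure p).real (Set.Ioi i) = (1 - p : ℝ) ^ (i + 1) := by
  have h1 : (geometricMeasure p).real (Set.Iic i) = 1 - (1 - p : ℝ) ^ (i + 1) := by
    have : (Set.Iic i) = ((Finset.range (i + 1) : Finset ℕ) : Set ℕ) := by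
      ext k; simp
    rw [this, ← sum_measureReal_singleton]
    simp_rw [geometricMeasure_real_singleton hp.ne']
    rw [← Finset.sum_mul]
    have := geom_sum_mul_neg (1 - p : ℝ) (i + 1)
    rw [sub_sub_cancel] at this
    exact this
  rw [← Set.compl_Iic, probReal_compl_eq_one_sub measurableSet_Iic, h1]
  ring

/-- The weight of the value selected in position `i` (counted from `0`) by a clairvoyant whose
selection number `D` is the first one to be disrupted. -/
noncomputable def clairvoyantWeight (ζ : ℝ) (D i : ℕ) : ℝ :=
  if i + 1 < D then 1 else if i + 1 = D then ζ else 0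

theorem clairvoyantReward_eq (ζ : ℝ) {n : ℕ} (x : Fin n → ℝ) (σ : Equiv.Perm (Fin n)) (D : ℕ) :
    clairvoyantReward ζ x σ D = ∑ i : Fin n, clairvoyantWeight ζ D i * x (σ i) := by
  unfold clairvoyantReward clairvoyantWeight
  refine Finset.sum_congr rfl fun i _ => ?_
  split_ifs <;> simp

theorem clairvoyantWeight_antitone {ζ : ℝ} (h0 : 0 ≤ ζ) (h1 : ζ ≤ 1) (D : ℕ) :
    Antitone (clairvoyantWeight ζ D) := by
  intro i j hij
  unfold clairvoyantWeight
  split_ifs <;> first | omega | linarith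

theorem clairvoyantWeight_mem {ζ : ℝ} (h0 : 0 ≤ ζ) (h1 : ζ ≤ 1) (D i : ℕ) :
    0 ≤ clairvoyantWeight ζ D i ∧ clairvoyantWeight ζ D i ≤ 1 := by
  unfold clairvoyantWeight
  split_ifs <;> constructor <;> linarith

/-- P(g > i) + ζ P(g = i) = (1 - p)^(i+1) + ζ p (1 - p)^i. -/
theorem integral_clairvoyantWeight (p : unitInterval) (hp : 0 < p) (ζ : ℝ) (i : ℕ) :
    ∫ g, clairvoyantWeight ζ (g + 1) i ∂geometricMeasure p =
      payFraction p ζ * (1 - p : ℝ) ^ i := by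
  have : (fun g => clairvoyantWeight ζ (g + 1) i) = fun g =>
      (Set.Ioi i).indicator (fun _ => (1 : ℝ)) g + ({i} : Set ℕ).indicator (fun _ => ζ) g := by
    ext g
    unfold clairvoyantWeight
    rcases lt_trichotomy i g with h | h | h
    · simp [h, h.ne']
    · simp [h]
    · simp [h.ne, h.not_gt, h.ne']
  rw [this, integral_add ((integrable_const _).indicator measurableSet_Ioi)
    ((integrable_const _).indicator (measurableSet_singleton _)),
    integral_indicator_const _ measurableSet_Ioi,
    integral_indicator_const _ (measurableSet_singleton _), geometricMeasure_real_Ioi p hp,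
    geometricMeasure_real_singleton hp.ne', payFraction]
  simp
  ring

/-- The permutation that sorts the values in decreasing order. -/
noncomputable def sortDescending {n : ℕ} (x : Fin n → ℝ) : Equiv.Perm (Fin n) :=
  Tuple.sort fun i => -x i

theorem antitone_sortDescending {n : ℕ} (x : Fin n → ℝ) :
    Antitone fun i => x (sortDescending x i) := by
  intro i j hij
  have := Tuple.monotone_sort (fun i => -x i) hij
  exact neg_le_neg_iff.1 this

/-- Rearrangement inequality: the weights decrease with the position, so sorting the values in
decreasing order is optimal, whatever D is. -/
theorem iSup_clairvoyantReward {ζ : ℝ} (h0 : 0 ≤ ζ) (h1 : ζ ≤ 1) {n : ℕ} (x : Fin n → ℝ) (D : ℕ) :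
    (⨆ σ : Equiv.Perm (Fin n), clairvoyantReward ζ x σ D) =
      ∑ i : Fin n, clairvoyantWeight ζ D i * x (sortDescending x i) := by
  refine le_antisymm (ciSup_le fun σ => ?_) ?_
  · rw [clairvoyantReward_eq]
    have hm : Monovary (fun i : Fin n => clairvoyantWeight ζ D i)
        (fun i => x (sortDescending x i)) := by
      refine Antitone.monovary ?_ (antitone_sortDescending x)
      exact fun i j hij => clairvoyantWeight_antitone h0 h1 D hij
    have := hm.sum_mul_comp_perm_le_sum_mul (σ := σ.trans (sortDescending x).symm)
    simpa using this
  · rw [← clairvoyantReward_eq]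
    exact le_ciSup (f := fun σ => clairvoyantReward ζ x σ D) (Set.finite_range _).bddAbove _

/-- The indices with t < a i form an initial segment; if it has length k, both sides equal 1 - q^k.
The product on the right does not depend on the order of the entries, which later removes the
sorting. -/
theorem sum_range_card_geometric (q : ℝ) {n : ℕ} (a : Fin n → ℝ) (ha : Antitone a) (t : ℝ) :
    (1 - q) * ∑ i : Fin n, q ^ (i : ℕ) * (if t < a i then 1 else 0) =
      1 - ∏ i : Fin n, (1 - (1 - q) * (if t < a i then 1 else 0)) := by
  induction n with
  | zero => simp
  | succ n ih =>
    rw [Fin.sum_univ_castSucc, Fin.prod_univ_castSucc, mul_add]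
    have := ih (fun i => a i.castSucc) (fun i j hij => ha (by simpa using hij))
    simp only [Fin.val_castSucc, Fin.val_last] at this ⊢
    rw [this]
    by_cases h : t < a (Fin.last n)
    · have h' : ∀ i : Fin n, t < a i.castSucc := fun i => h.trans_le (ha (Fin.le_last _))
      simp [h, h']
      ring
    · simp [h]

theorem sum_geometric_sortDescending (q : ℝ) {n : ℕ} (x : Fin n → ℝ) (t : ℝ) :
    (1 - q) * ∑ i : Fin n, q ^ (i : ℕ) * (if t < x (sortDescending x i) then 1 else 0) =
      1 - ∏ i : Fin n, (1 - (1 - q) * (if t < x i then 1 else 0)) := by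
  rw [sum_range_card_geometric q _ (antitone_sortDescending x),
    Equiv.prod_comp (sortDescending x) fun i => 1 - (1 - q) * (if t < x i then (1 : ℝ) else 0)]

theorem one_sub_prod_one_sub_le {ι : Type*} (s : Finset ι) (f : ι → ℝ) (h0 : ∀ i, 0 ≤ f i)
    (h1 : ∀ i, f i ≤ 1) :
    0 ≤ 1 - ∏ i ∈ s, (1 - f i) ∧ 1 - ∏ i ∈ s, (1 - f i) ≤ ∑ i ∈ s, f i := by
  classical
  constructor
  · rw [sub_nonneg]
    exact Finset.prod_le_one (fun i _ => sub_nonneg.2 (h1 i)) fun i _ => by linarith [h0 i]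
  · induction s using Finset.induction_on with
    | empty => simp
    | insert a s ha ih =>
      rw [Finset.prod_insert ha, Finset.sum_insert ha]
      have h2 : ∏ i ∈ s, (1 - f i) ≤ 1 :=
        Finset.prod_le_one (fun i _ => sub_nonneg.2 (h1 i)) fun i _ => by linarith [h0 i]
      nlinarith [h0 a, h1 a]

/-- The upper tail probability of a value. -/
noncomputable def ValueLaw.tail (F : ValueLaw) (t : ℝ) : ℝ := F.law.real (Set.Ioi t)

theorem ValueLaw.tail_antitone (F : ValueLaw) : Antitone F.tail :=
  fun _ _ h => measureReal_mono (Set.Ioi_subset_Ioi h)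

theorem ValueLaw.tail_nonneg (F : ValueLaw) (t : ℝ) : 0 ≤ F.tail t := measureReal_nonneg

theorem ValueLaw.tail_le_one (F : ValueLaw) (t : ℝ) : F.tail t ≤ 1 := measureReal_le_one

theorem ValueLaw.ae_nonneg (F : ValueLaw) : ∀ᵐ x ∂F.law, 0 ≤ x := by
  rw [ae_iff]
  have : {x : ℝ | ¬ 0 ≤ x} = Set.Iio 0 := by ext; simp
  rw [this, F.nonneg]

theorem integrable_indicator_lt_prod {Ω : Type*} [MeasurableSpace Ω] (μ : Measure Ω)
    [IsFiniteMeasure μ] {f : Ω → ℝ} (hf : Integrable f μ) (hm : Measurable f) :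
    Integrable (fun z : Ω × ℝ => if z.2 < f z.1 then (1 : ℝ) else 0)
      (μ.prod (volume.restrict (Set.Ioi 0))) := by
  have hs : MeasurableSet {z : Ω × ℝ | z.2 < f z.1} :=
    measurableSet_lt measurable_snd (hm.comp measurable_fst)
  have hlt : (μ.prod (volume.restrict (Set.Ioi 0))) {z : Ω × ℝ | z.2 < f z.1} < ⊤ := by
    rw [Measure.prod_apply hs]
    have : ∀ x, (volume.restrict (Set.Ioi (0 : ℝ))) (Prod.mk x ⁻¹' {z : Ω × ℝ | z.2 < f z.1}) =
        ENNReal.ofReal (f x) := by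
      intro x
      have : Prod.mk x ⁻¹' {z : Ω × ℝ | z.2 < f z.1} = Set.Iio (f x) := by ext; simp
      rw [this, Measure.restrict_apply measurableSet_Iio, Set.inter_comm, Set.Ioi_inter_Iio,
        Real.volume_Ioo, sub_zero]
    simp_rw [this]
    exact hf.lintegral_lt_top
  have := (integrable_indicator_iff (f := fun _ : Ω × ℝ => (1 : ℝ)) hs).2
    (integrableOn_const hlt.ne)
  refine this.congr (Eventually.of_forall fun z => ?_)
  simp [Set.indicator_apply]

theorem integral_indicator_lt {a : ℝ} (ha : 0 ≤ a) :
    ∫ t in Set.Ioi (0 : ℝ), (if t < a then (1 : ℝ) else 0) = a := by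
  have : (fun t : ℝ => if t < a then (1 : ℝ) else 0) = (Set.Iio a).indicator fun _ => (1 : ℝ) := by
    ext; simp [Set.indicator_apply]
  rw [this, integral_indicator_const _ measurableSet_Iio, measureReal_restrict_apply
    measurableSet_Iio, Set.inter_comm, Set.Ioi_inter_Iio]
  simp [ha]

theorem integrableOn_indicator_lt (a : ℝ) :
    IntegrableOn (fun t : ℝ => if t < a then (1 : ℝ) else 0) (Set.Ioi 0) := by
  have : (fun t : ℝ => if t < a then (1 : ℝ) else 0) = (Set.Iio a).indicator fun _ => (1 : ℝ) := by
    ext; simp [Set.indicator_apply]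
  rw [this, IntegrableOn, integrable_indicator_iff measurableSet_Iio, IntegrableOn,
    Measure.restrict_restrict measurableSet_Iio, Set.inter_comm, Set.Ioi_inter_Iio]
  exact integrableOn_const (by simp)

theorem sum_geometric_eq_integral (p : ℝ) {n : ℕ} (x : Fin n → ℝ) (hx : ∀ i, 0 ≤ x i) :
    p * ∑ i : Fin n, (1 - p) ^ (i : ℕ) * x (sortDescending x i) =
      ∫ t in Set.Ioi (0 : ℝ), (1 - ∏ i : Fin n, (1 - p * (if t < x i then 1 else 0))) := by
  have h := fun t => sum_geometric_sortDescending (1 - p) x t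
  simp only [sub_sub_cancel] at h
  simp_rw [← h]
  rw [integral_const_mul, integral_finsetSum]
  · simp_rw [integral_const_mul]
    congr 1
    refine Finset.sum_congr rfl fun i _ => ?_
    rw [integral_indicator_lt (hx _)]
  · exact fun i _ => (integrableOn_indicator_lt _).const_mul _

theorem ValueLaw.integrable_indicator_lt (F : ValueLaw) (t : ℝ) :
    Integrable (fun x : ℝ => if t < x then (1 : ℝ) else 0) F.law := by
  have : (fun x : ℝ => if t < x then (1 : ℝ) else 0) =
      (Set.Ioi t).indicator fun _ => (1 : ℝ) := by
    ext; simp [Set.indicator_apply]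
  rw [this]
  exact (integrable_const _).indicator measurableSet_Ioi

theorem ValueLaw.integral_indicator_lt (F : ValueLaw) (t : ℝ) :
    ∫ x, (if t < x then (1 : ℝ) else 0) ∂F.law = F.tail t := by
  have : (fun x : ℝ => if t < x then (1 : ℝ) else 0) =
      (Set.Ioi t).indicator fun _ => (1 : ℝ) := by
    ext; simp [Set.indicator_apply]
  rw [this, integral_indicator_const _ measurableSet_Ioi]
  simp [ValueLaw.tail]

theorem ValueLaw.integrableOn_tail (F : ValueLaw) : IntegrableOn F.tail (Set.Ioi 0) := by
  have h := (integrable_indicator_lt_prod F.law F.finite_mean measurable_id).integral_prod_right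
  exact h.congr (Eventually.of_forall fun t => F.integral_indicator_lt t)

theorem ValueLaw.integral_prod_indicator (F : ValueLaw) (p : ℝ) (n : ℕ) (t : ℝ) :
    ∫ x : Fin n → ℝ, (1 - ∏ i : Fin n, (1 - p * (if t < x i then 1 else 0)))
      ∂(Measure.pi fun _ => F.law) = 1 - (1 - p * F.tail t) ^ n := by
  have hi : Integrable (fun x : ℝ => 1 - p * (if t < x then (1 : ℝ) else 0)) F.law :=
    (integrable_const _).sub ((F.integrable_indicator_lt t).const_mul _)
  have he : ∫ x : ℝ, (1 - p * (if t < x then (1 : ℝ) else 0)) ∂F.law = 1 - p * F.tail t := by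
    rw [integral_sub (integrable_const _) ((F.integrable_indicator_lt t).const_mul _),
      integral_const_mul, F.integral_indicator_lt]
    simp
  have hp := integral_fintype_prod_eq_prod (fun (_ : Fin n) (x : ℝ) =>
    1 - p * (if t < x then (1 : ℝ) else 0)) (μ := fun _ => F.law)
  rw [integral_sub (integrable_const _) (Integrable.fintype_prod fun _ => hi), hp]
  simp only [he]
  simp

theorem ValueLaw.one_sub_pow_tail_bounds (F : ValueLaw) {p : ℝ} (hp0 : 0 ≤ p) (hp1 : p ≤ 1)
    (n : ℕ) (t : ℝ) :
    0 ≤ 1 - (1 - p * F.tail t) ^ n ∧ 1 - (1 - p * F.tail t) ^ n ≤ n * (p * F.tail t) := by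
  have h := one_sub_prod_one_sub_le (Finset.range n) (fun _ => p * F.tail t)
    (fun _ => mul_nonneg hp0 (F.tail_nonneg t))
    (fun _ => mul_le_one₀ hp1 (F.tail_nonneg t) (F.tail_le_one t))
  simpa using h

theorem ValueLaw.integrableOn_one_sub_pow_tail (F : ValueLaw) {p : ℝ} (hp0 : 0 ≤ p) (hp1 : p ≤ 1)
    (n : ℕ) : IntegrableOn (fun t => 1 - (1 - p * F.tail t) ^ n) (Set.Ioi 0) := by
  refine Integrable.mono' ((F.integrableOn_tail.const_mul p).const_mul n) ?_
    (Eventually.of_forall fun t => ?_)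
  · have := F.tail_antitone.measurable
    exact Measurable.aestronglyMeasurable (by fun_prop)
  · have := F.one_sub_pow_tail_bounds hp0 hp1 n t
    rw [Real.norm_of_nonneg this.1]
    exact this.2

/-- Averaging over D leaves the sorted values with geometric weights. Layer cake in t turns this sum
into a product over the unsorted values, and Fubini with independence evaluates its mean at each
level t. -/
theorem optValue_eq (p : unitInterval) (hp : 0 < p) {ζ : ℝ} (h0 : 0 ≤ ζ) (h1 : ζ ≤ 1) (n : ℕ)
    (F : ValueLaw) :
    optValue p ζ n F = payFraction p ζ / p *
      ∫ t in Set.Ioi (0 : ℝ), (1 - (1 - p * F.tail t) ^ n) := by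
  have hp' : (0 : ℝ) < p := hp
  have hsupm : Measurable fun z : (Fin n → ℝ) × ℕ =>
      (⨆ σ : Equiv.Perm (Fin n), clairvoyantReward ζ z.1 σ (z.2 + 1)) := by
    refine Measurable.iSup fun σ => ?_
    simp_rw [clairvoyantReward_eq]
    refine Finset.measurable_sum _ fun i _ => Measurable.mul ?_ ?_
    · exact (Measurable.of_discrete (f := fun g : ℕ => clairvoyantWeight ζ (g + 1) i)).comp
        measurable_snd
    · exact (measurable_pi_apply _).comp measurable_fst
  have hXi : ∀ i : Fin n, Integrable (fun x : Fin n → ℝ => x i) (Measure.pi fun _ => F.law) :=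
    fun i => (measurePreserving_eval (fun _ : Fin n => F.law) i).integrable_comp_of_integrable
      F.finite_mean
  have hint : Integrable (fun z : (Fin n → ℝ) × ℕ =>
      (⨆ σ : Equiv.Perm (Fin n), clairvoyantReward ζ z.1 σ (z.2 + 1)))
      ((Measure.pi fun _ : Fin n => F.law).prod (geometricMeasure p)) := by
    have hb : Integrable (fun z : (Fin n → ℝ) × ℕ => ∑ i, |z.1 i|)
        ((Measure.pi fun _ : Fin n => F.law).prod (geometricMeasure p)) :=
      integrable_finsetSum _ fun i _ => ((hXi i).abs.comp_fst _)
    refine hb.mono' hsupm.aestronglyMeasurable (Eventually.of_forall fun z => ?_)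
    rw [iSup_clairvoyantReward h0 h1, Real.norm_eq_abs]
    calc _ ≤ ∑ i : Fin n, |clairvoyantWeight ζ (z.2 + 1) i * z.1 (sortDescending z.1 i)| :=
          Finset.abs_sum_le_sum_abs _ _
      _ ≤ ∑ i : Fin n, |z.1 (sortDescending z.1 i)| := by
          refine Finset.sum_le_sum fun i _ => ?_
          have := clairvoyantWeight_mem h0 h1 (z.2 + 1) i
          rw [abs_mul, abs_of_nonneg this.1]
          exact mul_le_of_le_one_left (abs_nonneg _) this.2
      _ = _ := Equiv.sum_comp (sortDescending z.1) fun i => |z.1 i|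
  have hae : ∀ᵐ x ∂(Measure.pi fun _ : Fin n => F.law), ∀ i, 0 ≤ x i := by
    rw [ae_all_iff]
    intro i
    exact (measurePreserving_eval (fun _ : Fin n => F.law) i).quasiMeasurePreserving.ae
      F.ae_nonneg
  have hinner : ∀ᵐ x ∂(Measure.pi fun _ : Fin n => F.law),
      ∫ g, (⨆ σ : Equiv.Perm (Fin n), clairvoyantReward ζ x σ (g + 1)) ∂geometricMeasure p =
      payFraction p ζ / p * ∫ t in Set.Ioi (0 : ℝ),
        (1 - ∏ i : Fin n, (1 - (p : ℝ) * (if t < x i then 1 else 0))) := by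
    filter_upwards [hae] with x hx
    simp_rw [iSup_clairvoyantReward h0 h1]
    rw [integral_finsetSum, ← sum_geometric_eq_integral _ x hx]
    · simp_rw [integral_mul_const, integral_clairvoyantWeight p hp]
      rw [← mul_assoc, div_mul_cancel₀ _ hp'.ne', Finset.mul_sum]
      exact Finset.sum_congr rfl fun i _ => by ring
    · intro i _
      refine Integrable.mul_const (Integrable.of_bound (C := 1)
        (Measurable.of_discrete).aestronglyMeasurable (Eventually.of_forall fun g => ?_)) _
      have := clairvoyantWeight_mem h0 h1 (g + 1) i
      rw [Real.norm_of_nonneg this.1]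
      exact this.2
  unfold optValue
  rw [integral_prod _ hint, integral_congr_ae hinner, integral_const_mul, integral_integral_swap]
  · simp_rw [F.integral_prod_indicator]
  · have hb : Integrable (fun z : (Fin n → ℝ) × ℝ =>
        ∑ i, (p : ℝ) * (if z.2 < z.1 i then (1 : ℝ) else 0))
        ((Measure.pi fun _ : Fin n => F.law).prod (volume.restrict (Set.Ioi 0))) :=
      integrable_finsetSum _ fun i _ =>
        (integrable_indicator_lt_prod _ (hXi i) (measurable_pi_apply i)).const_mul _
    refine hb.mono' ?_ (Eventually.of_forall fun z => ?_)
    · refine Measurable.aestronglyMeasurable ?_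
      unfold Function.uncurry
      refine measurable_const.sub (Finset.measurable_prod _ fun i _ =>
        measurable_const.sub (measurable_const.mul (Measurable.ite ?_ measurable_const
          measurable_const)))
      exact measurableSet_lt measurable_snd ((measurable_pi_apply i).comp measurable_fst)
    · have := one_sub_prod_one_sub_le Finset.univ
        (fun i => (p : ℝ) * (if z.2 < z.1 i then (1 : ℝ) else 0))
        (fun i => mul_nonneg hp'.le (by split_ifs <;> norm_num))
        (fun i => mul_le_one₀ p.2.2 (by split_ifs <;> norm_num) (by split_ifs <;> norm_num))
      simp only [Function.uncurry]
      rw [Real.norm_of_nonneg this.1]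
      exact this.2

/-! ### Atomlessness, quantiles and truncated means of a value law -/

instance ValueLaw.nullSingletonClass (F : ValueLaw) : NullSingletonClass F.law := by
  refine ⟨fun a => ?_⟩
  rw [← measure_cdf F.law, StieltjesFunction.measure_singleton,
    leftLim_eq_of_tendsto (F.continuous_cdf.continuousAt.tendsto.mono_left
      nhdsWithin_le_nhds)]
  simp

theorem ValueLaw.real_Ici (F : ValueLaw) (t : ℝ) : F.law.real (Set.Ici t) = F.tail t :=
  measureReal_congr Ioi_ae_eq_Ici.symm

theorem ValueLaw.tail_eq (F : ValueLaw) (t : ℝ) : F.tail t = 1 - cdf F.law t := by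
  rw [cdf_eq_real, ValueLaw.tail, ← Set.compl_Iic, probReal_compl_eq_one_sub measurableSet_Iic]

theorem ValueLaw.continuous_tail (F : ValueLaw) : Continuous F.tail := by
  have : F.tail = fun t => 1 - cdf F.law t := funext F.tail_eq
  rw [this]
  exact continuous_const.sub F.continuous_cdf

theorem ValueLaw.tail_zero (F : ValueLaw) : F.tail 0 = 1 := by
  rw [← F.real_Ici, ← Set.compl_Iio, probReal_compl_eq_one_sub measurableSet_Iio, measureReal_def,
    F.nonneg]
  simp

theorem ValueLaw.exists_tail_eq (F : ValueLaw) {u : ℝ} (h0 : 0 < u) (h1 : u ≤ 1) :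
    ∃ τ, F.tail τ = u := by
  have ht : Tendsto F.tail atTop (𝓝 0) := by
    have : F.tail = fun t => 1 - cdf F.law t := funext F.tail_eq
    rw [this]
    simpa using (tendsto_const_nhds (x := (1 : ℝ))).sub (tendsto_cdf_atTop F.law)
  obtain ⟨b, hb, hb0⟩ := ((ht.eventually_lt_const h0).and (eventually_ge_atTop 0)).exists
  obtain ⟨τ, -, hτ⟩ := intermediate_value_Icc' hb0 F.continuous_tail.continuousOn
    ⟨hb.le, by rw [F.tail_zero]; exact h1⟩
  exact ⟨τ, hτ⟩

/-- Layer cake: for t > 0 the variable X 1{X ≥ τ} exceeds t when X passes the larger of τ and t, and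
the tail at the larger point is the smaller tail. -/
theorem ValueLaw.setIntegral_Ici (F : ValueLaw) (τ : ℝ) :
    ∫ x in Set.Ici τ, x ∂F.law = ∫ t in Set.Ioi (0 : ℝ), min (F.tail τ) (F.tail t) := by
  rw [← integral_indicator measurableSet_Ici, Integrable.integral_eq_integral_meas_lt
    (F.finite_mean.indicator measurableSet_Ici)]
  · refine setIntegral_congr_fun measurableSet_Ioi fun t ht => ?_
    have : {a : ℝ | t < (Set.Ici τ).indicator (fun x => x) a} = Set.Ici τ ∩ Set.Ioi t := by
      ext x
      by_cases hx : x ∈ Set.Ici τ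
      · simp [hx]
      · have h0 : ¬ t < 0 := not_lt.2 (le_of_lt ht)
        simp only [Set.mem_ofPred_eq, Set.indicator_of_notMem hx, Set.mem_inter_iff, hx, false_and,
          h0]
    simp only [this]
    rcases lt_or_ge t τ with h | h
    · have h2 : Set.Ici τ ∩ Set.Ioi t = Set.Ici τ :=
        Set.inter_eq_left.2 fun x hx => lt_of_lt_of_le h hx
      rw [h2, F.real_Ici, min_eq_left (F.tail_antitone h.le)]
    · have h2 : Set.Ici τ ∩ Set.Ioi t = Set.Ioi t :=
        Set.inter_eq_right.2 fun x hx => le_trans h (le_of_lt hx)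
      rw [h2, min_eq_right (F.tail_antitone h), ValueLaw.tail]
  · filter_upwards [F.ae_nonneg] with x hx
    simp only [Set.indicator_apply, Pi.zero_apply]
    split_ifs
    exacts [hx, le_rfl]

theorem ValueLaw.mean_pos (F : ValueLaw) : 0 < ∫ t in Set.Ioi (0 : ℝ), F.tail t := by
  rw [setIntegral_pos_iff_support_of_nonneg_ae (Eventually.of_forall F.tail_nonneg)
    F.integrableOn_tail]
  obtain ⟨b, hb⟩ := F.exists_tail_eq (u := 1 / 2) (by norm_num) (by norm_num)
  have hb0 : 0 < b := by
    by_contra h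
    have := F.tail_antitone (not_lt.1 h)
    rw [F.tail_zero, hb] at this
    norm_num at this
  have : Set.Ioo 0 b ⊆ Function.support F.tail ∩ Set.Ioi 0 := by
    intro t ht
    refine ⟨?_, ht.1⟩
    have := F.tail_antitone ht.2.le
    rw [hb] at this
    exact (lt_of_lt_of_le (by norm_num) this).ne'
  refine lt_of_lt_of_le ?_ (measure_mono this)
  simp [hb0]

theorem payFraction_pos {p : unitInterval} (hp1 : p < 1) {ζ : ℝ} (h0 : 0 ≤ ζ) :
    0 < payFraction p ζ := by
  have : (p : ℝ) < 1 := hp1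
  have := mul_nonneg h0 p.2.1
  unfold payFraction
  linarith

theorem optValue_pos {p : unitInterval} (hp : 0 < p) (hp1 : p < 1) {ζ : ℝ} (h0 : 0 ≤ ζ)
    (h1 : ζ ≤ 1) {n : ℕ} (hn : n ≠ 0) (F : ValueLaw) : 0 < optValue p ζ n F := by
  have hp' : (0 : ℝ) < p := hp
  rw [optValue_eq p hp h0 h1]
  refine mul_pos (div_pos (payFraction_pos hp1 h0) hp') ?_
  refine (mul_pos hp' F.mean_pos).trans_le ?_
  rw [← integral_const_mul]
  refine setIntegral_mono (F.integrableOn_tail.const_mul _)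
    (F.integrableOn_one_sub_pow_tail hp'.le p.2.2 n) fun t => ?_
  have h2 : (1 - p * F.tail t) ^ n ≤ 1 - p * F.tail t := by
    refine pow_le_of_le_one ?_ ?_ hn
    · have := mul_le_one₀ p.2.2 (F.tail_nonneg t) (F.tail_le_one t)
      linarith
    · have := mul_nonneg hp'.le (F.tail_nonneg t)
      linarith
  show (p : ℝ) * F.tail t ≤ 1 - (1 - p * F.tail t) ^ n
  linarith

/-! ### From stopping probabilities to a guarantee for every law -/

theorem prod_filter_lt_fin {n : ℕ} (i : Fin n) (g : ℕ → ℝ) :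
    ∏ j ∈ Finset.univ.filter (fun j : Fin n => j < i), g j = ∏ j ∈ Finset.range i, g j := by
  refine Finset.prod_nbij (fun j => (j : ℕ)) ?_ ?_ ?_ fun _ _ => rfl
  · intro j hj
    simpa using hj
  · exact fun a _ b _ h => Fin.ext h
  · intro k hk
    have hk' : k < i := by simpa using hk
    exact ⟨⟨k, hk'.trans i.2⟩, Finset.mem_coe.2 (Finset.mem_filter.2 ⟨Finset.mem_univ _, hk'⟩), rfl⟩

theorem thresholdValue_eq_sum_range (p : unitInterval) (ζ : ℝ) (F : ValueLaw) (n : ℕ)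
    (τ : ℕ → ℝ) :
    thresholdValue p ζ F (fun i : Fin n => τ i) = payFraction p ζ * ∑ i ∈ Finset.range n,
      (∏ j ∈ Finset.range i, (1 - p * F.tail (τ j))) * ∫ x in Set.Ici (τ i), x ∂F.law := by
  rw [thresholdValue_eq, Finset.sum_range]
  congr 1
  refine Finset.sum_congr rfl fun i _ => ?_
  rw [← prod_filter_lt_fin]
  simp_rw [F.real_Ici]

/-- Thresholds are taken at the quantiles where the stopping probability p G(τ) is u i. Online value
and benchmark are then integrals over levels t, and `hρ` at s = p G(t) compares the integrands. -/
theorem exists_thresholds_ge {p : unitInterval} (hp : 0 < p) {ζ : ℝ} (hζ : 0 ≤ ζ)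
    (hζ1 : ζ ≤ 1) {n : ℕ} {u : ℕ → ℝ} (hu : Monotone u) (h0 : ∀ i, 0 < u i)
    (h1 : ∀ i, u i ≤ p) {ρ : ℝ}
    (hρ : ∀ s : ℝ, 0 ≤ s → s ≤ p → ρ * (1 - (1 - s) ^ n) ≤
      ∑ i ∈ Finset.range n, (∏ j ∈ Finset.range i, (1 - u j)) * min (u i) s) (F : ValueLaw) :
    ∃ τ : Fin n → ℝ, Antitone τ ∧ ρ * optValue p ζ n F ≤ thresholdValue p ζ F τ := by
  have hp' : (0 : ℝ) < p := hp
  classical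
  have hq : ∀ i, ∃ τ, F.tail τ = u i / p := fun i =>
    F.exists_tail_eq (div_pos (h0 i) hp') ((div_le_one hp').2 (h1 i))
  -- The quantile is chosen as a function of the probability alone, so equal entries of u get equal
  -- thresholds. This matters for monotonicity, since the tail need not be injective.
  let q : ℝ → ℝ := fun a => if h : ∃ τ, F.tail τ = a / p then h.choose else 0
  have hqt : ∀ i, F.tail (q (u i)) = u i / p := by
    intro i
    simp only [q, dif_pos (hq i)]
    exact (hq i).choose_spec
  refine ⟨fun i => q (u i), ?_, ?_⟩
  · intro i j hij
    rcases (hu (Fin.le_def.1 hij)).eq_or_lt with h | h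
    · simp only [h, le_refl]
    · by_contra hc
      have := F.tail_antitone (le_of_not_ge hc)
      simp only at this
      rw [hqt i, hqt j] at this
      exact absurd this (not_le.2 (div_lt_div_of_pos_right h hp'))
  · have hint : ∀ i, IntegrableOn (fun t => min (u i / p) (F.tail t)) (Set.Ioi 0) := by
      intro i
      refine Integrable.mono' F.integrableOn_tail ?_ (Eventually.of_forall fun t => ?_)
      · exact (continuous_const.min F.continuous_tail).aestronglyMeasurable
      · rw [Real.norm_of_nonneg (le_min (div_pos (h0 i) hp').le (F.tail_nonneg t))]
        exact min_le_right _ _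
    rw [thresholdValue_eq_sum_range p ζ F n fun i => q (u i), optValue_eq p hp hζ hζ1]
    simp_rw [F.setIntegral_Ici, hqt, mul_div_cancel₀ _ hp'.ne']
    simp_rw [← integral_const_mul]
    rw [← integral_finsetSum _ fun i _ => (hint i).const_mul _]
    have hc : 0 ≤ payFraction p ζ := by
      unfold payFraction
      have := mul_nonneg hζ hp'.le
      linarith [p.2.2]
    rw [← integral_const_mul]
    refine setIntegral_mono
      (((F.integrableOn_one_sub_pow_tail hp'.le p.2.2 n).const_mul _).const_mul _)
      ((integrable_finsetSum _ fun i _ => (hint i).const_mul _).const_mul _) fun t => ?_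
    have h3 := hρ (p * F.tail t) (mul_nonneg hp'.le (F.tail_nonneg t))
      (mul_le_of_le_one_right hp'.le (F.tail_le_one t))
    have h4 : ∀ i, min (u i) (p * F.tail t) = p * min (u i / p) (F.tail t) := by
      intro i
      rw [mul_min_of_nonneg _ _ hp'.le, mul_div_cancel₀ _ hp'.ne']
    simp_rw [h4] at h3
    show ρ * (payFraction p ζ / p * (1 - (1 - p * F.tail t) ^ n)) ≤ payFraction p ζ *
      ∑ i ∈ Finset.range n, (∏ j ∈ Finset.range i, (1 - u j)) * min (u i / p) (F.tail t)
    calc _ = payFraction p ζ / p * (ρ * (1 - (1 - p * F.tail t) ^ n)) := by ring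
      _ ≤ _ := mul_le_mul_of_nonneg_left h3 (div_nonneg hc hp'.le)
      _ = _ := by
        rw [Finset.mul_sum, Finset.mul_sum]
        refine Finset.sum_congr rfl fun i _ => ?_
        field_simp

/-! ### A Bellman upper bound on all threshold sequences -/

theorem ValueLaw.setIntegral_Ici_nonneg (F : ValueLaw) (a : ℝ) : 0 ≤ ∫ x in Set.Ici a, x ∂F.law := by
  exact integral_nonneg_of_ae (ae_restrict_of_ae F.ae_nonneg)

theorem exists_nat_extension {n : ℕ} (τ : Fin n → ℝ) :
    ∃ τ' : ℕ → ℝ, τ = fun i : Fin n => τ' i :=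
  ⟨fun i => if h : i < n then τ ⟨i, h⟩ else 0, by ext i; simp⟩

theorem thresholdValue_nonneg {p : unitInterval} {ζ : ℝ} (hζ : 0 ≤ ζ) (F : ValueLaw) {n : ℕ}
    (τ : Fin n → ℝ) : 0 ≤ thresholdValue p ζ F τ := by
  rw [thresholdValue_eq]
  have hc : 0 ≤ payFraction p ζ := by
    unfold payFraction
    have := mul_nonneg hζ p.2.1
    linarith [p.2.2]
  refine mul_nonneg hc (Finset.sum_nonneg fun i _ => mul_nonneg (Finset.prod_nonneg fun j _ => ?_)
    (F.setIntegral_Ici_nonneg _))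
  have := mul_le_one₀ p.2.2 (measureReal_nonneg (μ := F.law) (s := Set.Ici (τ j)))
    measureReal_le_one
  linarith

/-- W is a supersolution of the Bellman recursion, in units of `payFraction p ζ / p`: selecting x
gains x and forfeits the continuation, both at rate p. No threshold does better than selecting
exactly when x exceeds the continuation value. -/
theorem thresholdValue_le {p : unitInterval} (hp : 0 < p) {ζ : ℝ} (hζ : 0 ≤ ζ) (F : ValueLaw)
    {n : ℕ} {W : ℕ → ℝ} (hn : 0 ≤ W n)
    (hW : ∀ i < n, W (i + 1) + p * ∫ x, max (x - W (i + 1)) 0 ∂F.law ≤ W i) (τ : Fin n → ℝ) :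
    thresholdValue p ζ F τ ≤ payFraction p ζ / p * W 0 := by
  have hp' : (0 : ℝ) < p := hp
  obtain ⟨σ, rfl⟩ := exists_nat_extension τ
  rw [thresholdValue_eq_sum_range]
  have hc : 0 ≤ payFraction p ζ := by
    unfold payFraction
    have := mul_nonneg hζ hp'.le
    linarith [p.2.2]
  have hg : ∀ j, 0 ≤ 1 - p * F.tail (σ j) := fun j => by
    have := mul_le_one₀ p.2.2 (F.tail_nonneg (σ j)) (F.tail_le_one (σ j))
    linarith
  have key : ∀ i < n, p * ∫ x in Set.Ici (σ i), x ∂F.law ≤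
      W i - (1 - p * F.tail (σ i)) * W (i + 1) := by
    intro i hi
    have hint : Integrable (fun x => x - W (i + 1)) F.law :=
      F.finite_mean.sub (integrable_const _)
    have h1 : ∫ x in Set.Ici (σ i), x ∂F.law - F.tail (σ i) * W (i + 1) ≤
        ∫ x, max (x - W (i + 1)) 0 ∂F.law := by
      have h2 : ∫ x in Set.Ici (σ i), x ∂F.law - F.tail (σ i) * W (i + 1) =
          ∫ x in Set.Ici (σ i), (x - W (i + 1)) ∂F.law := by
        rw [integral_sub F.finite_mean.integrableOn (integrable_const _).integrableOn,
          setIntegral_const, F.real_Ici, smul_eq_mul]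
      rw [h2, ← integral_indicator measurableSet_Ici]
      refine integral_mono (hint.indicator measurableSet_Ici) hint.pos_part fun x => ?_
      by_cases hx : x ∈ Set.Ici (σ i)
      · rw [Set.indicator_of_mem hx]
        exact le_max_left _ _
      · rw [Set.indicator_of_notMem hx]
        exact le_max_right _ _
    nlinarith [hW i hi, mul_le_mul_of_nonneg_left h1 hp'.le]
  -- Weighting the one-step inequalities by the survival probabilities makes the W terms telescope.
  have tele : ∀ m ≤ n, ∑ i ∈ Finset.range m, (∏ j ∈ Finset.range i, (1 - p * F.tail (σ j))) *
      (p * ∫ x in Set.Ici (σ i), x ∂F.law) ≤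
      W 0 - (∏ j ∈ Finset.range m, (1 - p * F.tail (σ j))) * W m := by
    intro m
    induction m with
    | zero => simp
    | succ m ih =>
      intro hm
      rw [Finset.sum_range_succ, Finset.prod_range_succ]
      have := mul_le_mul_of_nonneg_left (key m hm)
        (Finset.prod_nonneg fun j (_ : j ∈ Finset.range m) => hg j)
      linarith [ih (by omega)]
  have h5 := tele n le_rfl
  have h6 : 0 ≤ (∏ j ∈ Finset.range n, (1 - p * F.tail (σ j))) * W n :=
    mul_nonneg (Finset.prod_nonneg fun j _ => hg j) hn
  have h7 : ∑ i ∈ Finset.range n, (∏ j ∈ Finset.range i, (1 - p * F.tail (σ j))) *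
      (p * ∫ x in Set.Ici (σ i), x ∂F.law) = p * ∑ i ∈ Finset.range n,
      (∏ j ∈ Finset.range i, (1 - p * F.tail (σ j))) * ∫ x in Set.Ici (σ i), x ∂F.law := by
    rw [Finset.mul_sum]
    exact Finset.sum_congr rfl fun i _ => by ring
  rw [h7] at h5
  rw [div_mul_eq_mul_div, mul_div_assoc]
  refine mul_le_mul_of_nonneg_left ?_ hc
  rw [le_div_iff₀ hp']
  linarith

/-! ### The Hill–Kertz function and its constant -/

/-- The Hill–Kertz function `s - s ln s + c`, extended by constants outside `[0, 1]`. -/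
noncomputable def hillKertz (c s : ℝ) : ℝ :=
  max 0 (min 1 s) + Real.negMulLog (max 0 (min 1 s)) + c

theorem hillKertz_of_mem (c : ℝ) {s : ℝ} (h0 : 0 ≤ s) (h1 : s ≤ 1) :
    hillKertz c s = s - s * Real.log s + c := by
  unfold hillKertz Real.negMulLog
  rw [min_eq_right h1, max_eq_right h0]
  ring

theorem continuous_hillKertz (c : ℝ) : Continuous (hillKertz c) := by
  unfold hillKertz
  have h : Continuous fun s : ℝ => max 0 (min 1 s) := by fun_prop
  exact (h.add (Real.continuous_negMulLog.comp h)).add continuous_const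

theorem hillKertz_one (c : ℝ) : hillKertz c 1 = 1 + c := by simp [hillKertz]

theorem hasDerivAt_hillKertz (c : ℝ) {s : ℝ} (h0 : 0 < s) (h1 : s < 1) :
    HasDerivAt (hillKertz c) (-Real.log s) s := by
  have h : HasDerivAt (fun s => s + Real.negMulLog s + c) (-Real.log s) s := by
    convert! ((hasDerivAt_id s).add (Real.hasDerivAt_negMulLog h0.ne')).add_const c using 1
    ring
  refine h.congr_of_eventuallyEq ?_
  filter_upwards [lt_mem_nhds h0, gt_mem_nhds h1] with x hx0 hx1
  rw [hillKertz, min_eq_right hx1.le, max_eq_right hx0.le]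

theorem hillKertz_monotone (c : ℝ) : Monotone (hillKertz c) := by
  have h : MonotoneOn (hillKertz c) (Set.Icc 0 1) := by
    refine monotoneOn_of_deriv_nonneg (convex_Icc 0 1) (continuous_hillKertz c).continuousOn ?_ ?_
    · rw [interior_Icc]
      exact fun s hs => (hasDerivAt_hillKertz c hs.1 hs.2).differentiableAt.differentiableWithinAt
    · rw [interior_Icc]
      intro s hs
      rw [(hasDerivAt_hillKertz c hs.1 hs.2).deriv]
      exact neg_nonneg.2 (Real.log_nonpos hs.1.le hs.2.le)
  have hproj : ∀ s, hillKertz c s = hillKertz c (max 0 (min 1 s)) := by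
    intro s
    unfold hillKertz
    rw [min_eq_right (a := 1) (b := max 0 (min 1 s)) (by simp), max_eq_right (a := 0)
      (b := max 0 (min 1 s)) (by simp)]
  intro s t hst
  rw [hproj s, hproj t]
  exact h ⟨by simp, by simp⟩ ⟨by simp, by simp⟩ (max_le_max le_rfl (min_le_min le_rfl hst))

theorem le_hillKertz (c s : ℝ) : c ≤ hillKertz c s := by
  have h0 : 0 ≤ max 0 (min 1 s) := le_max_left _ _
  have := Real.negMulLog_nonneg h0 (by simp)
  unfold hillKertz
  linarith

theorem hillKertz_pos {c : ℝ} (hc : 0 < c) (s : ℝ) : 0 < hillKertz c s :=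
  hc.trans_le (le_hillKertz c s)

theorem hillKertz_le_one_add (c : ℝ) {s : ℝ} (hs : s ≤ 1) : hillKertz c s ≤ 1 + c := by
  rw [← hillKertz_one]
  exact hillKertz_monotone c hs

theorem continuous_inv_hillKertz {c : ℝ} (hc : 0 < c) : Continuous fun s => (hillKertz c s)⁻¹ :=
  (continuous_hillKertz c).inv₀ fun s => (hillKertz_pos hc s).ne'

/-- The time it takes the Hill–Kertz curve to fall from `y` to `0`. -/
noncomputable def hillKertzTime (c y : ℝ) : ℝ := ∫ s in (0 : ℝ)..y, (hillKertz c s)⁻¹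

theorem hillKertzTime_one (c : ℝ) :
    hillKertzTime c 1 = ∫ y in (0 : ℝ)..1, (y - y * Real.log y + c)⁻¹ := by
  refine intervalIntegral.integral_congr fun s hs => ?_
  rw [Set.uIcc_of_le zero_le_one] at hs
  simp only [hillKertz_of_mem c hs.1 hs.2]

theorem hasDerivAt_hillKertzTime {c : ℝ} (hc : 0 < c) (y : ℝ) :
    HasDerivAt (hillKertzTime c) (hillKertz c y)⁻¹ y :=
  ((continuous_inv_hillKertz hc).integral_hasStrictDerivAt 0 y).hasDerivAt

theorem hillKertzTime_zero (c : ℝ) : hillKertzTime c 0 = 0 := intervalIntegral.integral_same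

theorem hillKertzTime_strictMono {c : ℝ} (hc : 0 < c) : StrictMono (hillKertzTime c) := by
  refine strictMono_of_deriv_pos fun s => ?_
  rw [(hasDerivAt_hillKertzTime hc s).deriv]
  exact inv_pos.2 (hillKertz_pos hc s)

theorem continuous_hillKertzTime {c : ℝ} (hc : 0 < c) : Continuous (hillKertzTime c) :=
  continuous_iff_continuousAt.2 fun y => (hasDerivAt_hillKertzTime hc y).continuousAt

theorem hillKertzTime_one_strictAntiOn :
    StrictAntiOn (fun c => hillKertzTime c 1) (Set.Ioi 0) := by
  intro a ha b hb hab
  refine intervalIntegral.integral_lt_integral_of_continuousOn_of_le_of_exists_lt zero_lt_one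
    (continuous_inv_hillKertz hb).continuousOn (continuous_inv_hillKertz ha).continuousOn
    (fun s _ => ?_) ⟨1, ⟨zero_le_one, le_rfl⟩, ?_⟩
  · exact inv_anti₀ (hillKertz_pos ha s) (by unfold hillKertz; linarith)
  · exact inv_strictAnti₀ (hillKertz_pos ha 1) (by unfold hillKertz; linarith)

theorem hillKertzTime_one_continuousOn {δ : ℝ} (hδ : 0 < δ) :
    ContinuousOn (fun c => hillKertzTime c 1) (Set.Ici δ) := by
  -- For c ≥ δ the truncation at δ changes nothing, and it makes the integrand jointly continuous
  -- for all real c.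
  have h : Continuous fun c => ∫ s in (0 : ℝ)..1, (max (hillKertz c s) δ)⁻¹ := by
    refine intervalIntegral.continuous_parametric_intervalIntegral_of_continuous' ?_ 0 1
    refine Continuous.inv₀ (Continuous.max ?_ continuous_const) fun z =>
      (hδ.trans_le (le_max_right _ _)).ne'
    have h1 : Continuous fun z : ℝ × ℝ => max 0 (min 1 z.2) := by fun_prop
    unfold hillKertz
    exact (h1.add (Real.continuous_negMulLog.comp h1)).add continuous_fst
  refine h.continuousOn.congr fun c hc => ?_
  refine intervalIntegral.integral_congr fun s _ => ?_
  simp only [max_eq_left (le_trans hc (le_hillKertz c s))]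

theorem hillKertzTime_one_one_lt : hillKertzTime 1 1 < 1 := by
  have : ∫ s in (0 : ℝ)..1, (hillKertz 1 s)⁻¹ < ∫ s in (0 : ℝ)..1, (1 : ℝ) := by
    refine intervalIntegral.integral_lt_integral_of_continuousOn_of_le_of_exists_lt zero_lt_one
      (continuous_inv_hillKertz one_pos).continuousOn continuousOn_const
      (fun s _ => inv_le_one_of_one_le₀ (le_hillKertz 1 s)) ⟨1, ⟨zero_le_one, le_rfl⟩, ?_⟩
    rw [hillKertz_one]
    norm_num
  rw [intervalIntegral.integral_const, sub_zero, one_smul] at this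
  exact this

/-- On [δ, 1] with δ = e⁻⁴ the added constant δ is at most s, so h(s) ≤ s(2 - ln s). The reciprocal
of this bound has primitive -ln(2 - ln s) and integral ln(6/2) = ln 3 > 1. -/
theorem one_lt_hillKertzTime_one : 1 < hillKertzTime (Real.exp (-4)) 1 := by
  set δ := Real.exp (-4) with hδ
  have hδ0 : 0 < δ := Real.exp_pos _
  have hδ1 : δ < 1 := Real.exp_lt_one_iff.2 (by norm_num)
  have hlog : ∀ s, δ ≤ s → s ≤ 1 → 0 < 2 - Real.log s := fun s h0 h1 => by
    linarith [Real.log_nonpos (hδ0.le.trans h0) h1]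
  have hd : ∀ s ∈ Set.uIcc δ 1, HasDerivAt (fun s => -Real.log (2 - Real.log s))
      ((s * (2 - Real.log s))⁻¹) s := by
    intro s hs
    rw [Set.uIcc_of_le hδ1.le] at hs
    have hs0 : 0 < s := hδ0.trans_le hs.1
    have h2 := hlog s hs.1 hs.2
    convert! (((hasDerivAt_const s (2 : ℝ)).sub (Real.hasDerivAt_log hs0.ne')).log h2.ne').neg
      using 1
    rw [Pi.sub_apply]
    field_simp
    ring
  have hcont : ContinuousOn (fun s => (s * (2 - Real.log s))⁻¹) (Set.uIcc δ 1) := by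
    rw [Set.uIcc_of_le hδ1.le]
    refine ContinuousOn.inv₀ (continuousOn_id.mul (continuousOn_const.sub
      (Real.continuousOn_log.mono fun s hs => ?_))) fun s hs => ?_
    · exact (hδ0.trans_le hs.1).ne'
    · exact (mul_pos (hδ0.trans_le hs.1) (hlog s hs.1 hs.2)).ne'
  have hint := intervalIntegral.integral_eq_sub_of_hasDerivAt hd hcont.intervalIntegrable
  have hval : ∫ s in δ..1, (s * (2 - Real.log s))⁻¹ = Real.log 3 := by
    rw [hint, hδ, Real.log_exp, Real.log_one, show (3 : ℝ) = (2 - -4) / (2 - 0) by norm_num,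
      Real.log_div (by norm_num) (by norm_num)]
    ring
  have hle : ∫ s in δ..1, (s * (2 - Real.log s))⁻¹ ≤ ∫ s in δ..1, (hillKertz δ s)⁻¹ := by
    refine intervalIntegral.integral_mono_on hδ1.le hcont.intervalIntegrable
      ((continuous_inv_hillKertz hδ0).intervalIntegrable _ _) fun s hs => ?_
    refine inv_anti₀ (hillKertz_pos hδ0 s) ?_
    rw [hillKertz_of_mem δ (hδ0.le.trans hs.1) hs.2]
    nlinarith [hs.1]
  have hsub : ∫ s in δ..1, (hillKertz δ s)⁻¹ ≤ hillKertzTime δ 1 := by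
    rw [hillKertzTime, ← intervalIntegral.integral_add_adjacent_intervals
      ((continuous_inv_hillKertz hδ0).intervalIntegrable 0 δ)
      ((continuous_inv_hillKertz hδ0).intervalIntegrable δ 1)]
    have : 0 ≤ ∫ s in (0 : ℝ)..δ, (hillKertz δ s)⁻¹ :=
      intervalIntegral.integral_nonneg hδ0.le fun s _ => (inv_pos.2 (hillKertz_pos hδ0 s)).le
    linarith
  have h3 : 1 < Real.log 3 := by
    rw [Real.lt_log_iff_exp_lt (by norm_num)]
    exact Real.exp_one_lt_d9.trans (by norm_num)
  linarith

theorem isHillKertzConstant_iff (θ : ℝ) :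
    IsHillKertzConstant θ ↔ ∃ c, 0 < c ∧ θ = (1 + c)⁻¹ ∧ hillKertzTime c 1 = 1 := by
  constructor
  · rintro ⟨h0, h1, h⟩
    refine ⟨1 / θ - 1, ?_, by field_simp; ring, by rw [hillKertzTime_one, h]⟩
    rw [sub_pos, lt_div_iff₀ h0]
    linarith
  · rintro ⟨c, hc, rfl, h⟩
    refine ⟨by positivity, inv_lt_one_of_one_lt₀ (by linarith), ?_⟩
    rw [hillKertzTime_one] at h
    simpa using h

theorem existsUnique_hillKertzConstant : ∃! θ : ℝ, IsHillKertzConstant θ := by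
  obtain ⟨c, hc, hc1⟩ := intermediate_value_Icc' (f := fun c => hillKertzTime c 1)
    (Real.exp_le_one_iff.2 (by norm_num : (-4 : ℝ) ≤ 0))
    ((hillKertzTime_one_continuousOn (Real.exp_pos (-4))).mono Set.Icc_subset_Ici_self)
    ⟨hillKertzTime_one_one_lt.le, one_lt_hillKertzTime_one.le⟩
  have hc0 : 0 < c := (Real.exp_pos _).trans_le hc.1
  refine ⟨(1 + c)⁻¹, (isHillKertzConstant_iff _).2 ⟨c, hc0, rfl, hc1⟩, fun θ hθ => ?_⟩
  obtain ⟨d, hd, rfl, hd1⟩ := (isHillKertzConstant_iff θ).1 hθ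
  rw [hillKertzTime_one_strictAntiOn.injOn hd hc0 (hd1.trans hc1.symm)]

/-! ### Discretised curve and stopping probabilities -/

/-- The points that cut the Hill–Kertz curve into `n` pieces of equal duration. -/
theorem exists_hillKertz_partition {c : ℝ} (hc : 0 < c) (h1 : hillKertzTime c 1 = 1) {n : ℕ}
    (hn : n ≠ 0) :
    ∃ y : ℕ → ℝ, Antitone y ∧ y 0 = 1 ∧ y n = 0 ∧ (∀ i, y (i + 1) < 1) ∧ (∀ i, 0 ≤ y i) ∧
      (∀ i < n, 0 < y i) ∧
      ∀ i < n, hillKertzTime c (y i) - hillKertzTime c (y (i + 1)) = (n : ℝ)⁻¹ := by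
  have hn' : (0 : ℝ) < n := by exact_mod_cast Nat.pos_of_ne_zero hn
  -- y i is the height of the curve at time i/n; the maximum with 0 freezes it at 0 for i ≥ n.
  have hex : ∀ i : ℕ, ∃ y, 0 ≤ y ∧ y ≤ 1 ∧ hillKertzTime c y = max (1 - (i : ℝ) / n) 0 := by
    intro i
    obtain ⟨y, hy, h⟩ := intermediate_value_Icc (f := hillKertzTime c) zero_le_one
      (continuous_hillKertzTime hc).continuousOn (show max (1 - (i : ℝ) / n) 0 ∈ _ by
        rw [hillKertzTime_zero, h1]
        exact ⟨le_max_right _ _, max_le (by linarith [show (0 : ℝ) ≤ i / n by positivity])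
          zero_le_one⟩)
    exact ⟨y, hy.1, hy.2, h⟩
  choose y hy0 hy1 hy using hex
  have hmono := hillKertzTime_strictMono hc
  refine ⟨y, ?_, ?_, ?_, ?_, hy0, ?_, ?_⟩
  · intro i j hij
    rw [← hmono.le_iff_le, hy, hy]
    gcongr
  · apply hmono.injective
    rw [hy, h1]
    simp
  · apply hmono.injective
    rw [hy, hillKertzTime_zero]
    simp [hn'.ne']
  · intro i
    rw [← hmono.lt_iff_lt, hy, h1]
    refine max_lt ?_ one_pos
    have : (0 : ℝ) < ((i + 1 : ℕ) : ℝ) / n := by positivity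
    linarith
  · intro i hi
    rw [← hmono.lt_iff_lt, hy, hillKertzTime_zero]
    refine lt_max_of_lt_left ?_
    rw [sub_pos, div_lt_one hn']
    exact_mod_cast hi
  · intro i hi
    rw [hy, hy, max_eq_left, max_eq_left]
    · push_cast
      field_simp
      ring
    · rw [sub_nonneg, div_le_one hn']
      exact_mod_cast hi
    · rw [sub_nonneg, div_le_one hn']
      exact_mod_cast hi.le

/-- Along the curve ln h decreases at rate -ln y, which is at least -ln b once y ≤ b. In terms of
height, ln h + (ln b) T has derivative (ln b - ln s)/h(s) ≥ 0 on (a, b). -/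
theorem hillKertz_decay {c : ℝ} (hc : 0 < c) {a b : ℝ} (ha : 0 ≤ a) (hab : a ≤ b) (hb : b ≤ 1) :
    hillKertz c a ≤
      hillKertz c b * Real.exp (Real.log b * (hillKertzTime c b - hillKertzTime c a)) := by
  have hm : MonotoneOn (fun s => Real.log (hillKertz c s) + Real.log b * hillKertzTime c s)
      (Set.Icc a b) := by
    have hd : ∀ s ∈ Set.Ioo a b, HasDerivAt
        (fun s => Real.log (hillKertz c s) + Real.log b * hillKertzTime c s)
        (-Real.log s / hillKertz c s + Real.log b * (hillKertz c s)⁻¹) s := fun s hs =>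
      ((hasDerivAt_hillKertz c (ha.trans_lt hs.1) (hs.2.trans_le hb)).log
        (hillKertz_pos hc s).ne').add ((hasDerivAt_hillKertzTime hc s).const_mul _)
    refine monotoneOn_of_deriv_nonneg (convex_Icc a b) ?_ ?_ ?_
    · exact (((continuous_hillKertz c).log fun s => (hillKertz_pos hc s).ne').add
        (continuous_const.mul (continuous_hillKertzTime hc))).continuousOn
    · rw [interior_Icc]
      exact fun s hs => (hd s hs).differentiableAt.differentiableWithinAt
    · rw [interior_Icc]
      intro s hs
      rw [(hd s hs).deriv, div_eq_mul_inv, ← add_mul]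
      refine mul_nonneg ?_ (inv_pos.2 (hillKertz_pos hc s)).le
      linarith [Real.log_le_log (ha.trans_lt hs.1) hs.2.le]
  have h := hm ⟨le_rfl, hab⟩ ⟨hab, le_rfl⟩ hab
  simp only at h
  rw [← Real.log_le_log_iff (hillKertz_pos hc a) (mul_pos (hillKertz_pos hc b) (Real.exp_pos _)),
    Real.log_mul (hillKertz_pos hc b).ne' (Real.exp_pos _).ne', Real.log_exp]
  linarith

/-- The function `s ↦ min (-ln s) a`. -/
noncomputable def truncNegLog (a s : ℝ) : ℝ := -Real.log (max s (Real.exp (-a)))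

theorem continuous_truncNegLog (a : ℝ) : Continuous (truncNegLog a) := by
  unfold truncNegLog
  exact ((continuous_id.max continuous_const).log fun s =>
    ((Real.exp_pos _).trans_le (le_max_right _ _)).ne').neg

theorem truncNegLog_antitone (a : ℝ) : Antitone (truncNegLog a) := fun _ _ h =>
  neg_le_neg (Real.log_le_log ((Real.exp_pos _).trans_le (le_max_right _ _))
    (max_le_max h le_rfl))

theorem truncNegLog_le (a s : ℝ) : truncNegLog a s ≤ a := by
  have := Real.log_le_log (Real.exp_pos (-a)) (le_max_right s (Real.exp (-a)))
  rw [Real.log_exp] at this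
  unfold truncNegLog
  linarith

theorem truncNegLog_le_neg_log (a : ℝ) {s : ℝ} (hs : 0 < s) : truncNegLog a s ≤ -Real.log s :=
  neg_le_neg (Real.log_le_log hs (le_max_left _ _))

theorem truncNegLog_pos {a s : ℝ} (ha : 0 < a) (hs : s < 1) : 0 < truncNegLog a s :=
  neg_pos.2 (Real.log_neg ((Real.exp_pos _).trans_le (le_max_right _ _))
    (max_lt hs (Real.exp_lt_one_iff.2 (by linarith))))

theorem truncNegLog_nonneg {a s : ℝ} (ha : 0 ≤ a) (hs : s ≤ 1) : 0 ≤ truncNegLog a s :=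
  neg_nonneg.2 (Real.log_nonpos ((Real.exp_pos _).trans_le (le_max_right _ _)).le
    (max_le hs (Real.exp_le_one_iff.2 (by linarith))))

theorem min_truncNegLog {a b : ℝ} (h : a ≤ b) (s : ℝ) :
    min (truncNegLog b s) a = truncNegLog a s := by
  have hs : max s (Real.exp (-a)) = max (max s (Real.exp (-b))) (Real.exp (-a)) := by
    rw [max_assoc, max_eq_right (Real.exp_le_exp.2 (neg_le_neg h))]
  unfold truncNegLog
  rw [hs]
  have hb : 0 < max s (Real.exp (-b)) := (Real.exp_pos _).trans_le (le_max_right _ _)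
  rcases le_total (max s (Real.exp (-b))) (Real.exp (-a)) with h1 | h1
  · rw [max_eq_right h1, Real.log_exp, neg_neg, min_eq_right]
    have := Real.log_le_log hb h1
    rw [Real.log_exp] at this
    linarith
  · rw [max_eq_left h1, min_eq_left]
    have := Real.log_le_log (Real.exp_pos _) h1
    rw [Real.log_exp] at this
    linarith

/-- If U is uniform on [0, 1], then -ln U is a standard exponential variable, and this is its mean
truncated at a. -/
theorem integral_truncNegLog {a : ℝ} (ha : 0 ≤ a) :
    ∫ s in (0 : ℝ)..1, truncNegLog a s = 1 - Real.exp (-a) := by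
  have he0 := Real.exp_pos (-a)
  have he1 : Real.exp (-a) ≤ 1 := Real.exp_le_one_iff.2 (by linarith)
  rw [← intervalIntegral.integral_add_adjacent_intervals
    ((continuous_truncNegLog a).intervalIntegrable 0 (Real.exp (-a)))
    ((continuous_truncNegLog a).intervalIntegrable _ 1)]
  have h1 : ∫ s in (0 : ℝ)..Real.exp (-a), truncNegLog a s =
      ∫ s in (0 : ℝ)..Real.exp (-a), a := by
    refine intervalIntegral.integral_congr fun s hs => ?_
    rw [Set.uIcc_of_le he0.le] at hs
    simp only [truncNegLog, max_eq_right hs.2, Real.log_exp, neg_neg]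
  have h2 : ∫ s in Real.exp (-a)..1, truncNegLog a s =
      ∫ s in Real.exp (-a)..1, -Real.log s := by
    refine intervalIntegral.integral_congr fun s hs => ?_
    rw [Set.uIcc_of_le he1] at hs
    simp only [truncNegLog, max_eq_left hs.1]
  rw [h1, h2, intervalIntegral.integral_neg, integral_log]
  simp
  ring

theorem mul_exp_neg_le_one_sub_exp_neg (x : ℝ) : x * Real.exp (-x) ≤ 1 - Real.exp (-x) := by
  have h1 := Real.add_one_le_exp x
  have h2 : Real.exp x * Real.exp (-x) = 1 := by rw [← Real.exp_add]; simp
  nlinarith [Real.exp_pos (-x)]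

/-- Discrete form of stopping at rate -ln y truncated at K. The two factors e^{-K/n} hidden in
e^{-2K/n} pay for an index shift in the survival bound and for replacing 1 - e^{-x} by x; the factor
1 - e^{-K} pays for the truncation. -/
theorem exists_acceptance_probabilities {c : ℝ} (hc : 0 < c) (h1 : hillKertzTime c 1 = 1) {n : ℕ}
    (hn : n ≠ 0) {K : ℝ} (hK : 0 < K) :
    ∃ u : ℕ → ℝ, Monotone u ∧ (∀ i, 0 < u i) ∧ (∀ i, u i ≤ 1 - Real.exp (-(K / n))) ∧
      ∀ s : ℝ, 0 ≤ s → s < 1 →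
        (1 + c)⁻¹ * Real.exp (-(2 * K / n)) * (1 - Real.exp (-K)) * (1 - (1 - s) ^ n) ≤
        ∑ i ∈ Finset.range n, (∏ j ∈ Finset.range i, (1 - u j)) * min (u i) s := by
  have hn' : (0 : ℝ) < n := by exact_mod_cast Nat.pos_of_ne_zero hn
  obtain ⟨y, hanti, hy0, hyn, hy1, hnn, hpos, hT⟩ := exists_hillKertz_partition hc h1 hn
  have hyle : ∀ i, y i ≤ 1 := fun i => hy0 ▸ hanti (Nat.zero_le i)
  -- The rate is read at the end of each step: at y 0 = 1 it would be zero. At y n = 0 the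
  -- truncation gives K.
  set l : ℕ → ℝ := fun i => truncNegLog K (y (i + 1)) with hl
  have hl0 : ∀ i, 0 < l i := fun i => truncNegLog_pos hK (hy1 i)
  have hlK : ∀ i, l i ≤ K := fun i => truncNegLog_le K _
  set u : ℕ → ℝ := fun i => 1 - Real.exp (-(l i / n)) with hu
  have hu0 : ∀ i, 0 < u i := fun i => by
    have : Real.exp (-(l i / n)) < 1 :=
      Real.exp_lt_one_iff.2 (neg_neg_of_pos (div_pos (hl0 i) hn'))
    simp only [hu]
    linarith
  have hu1 : ∀ i, u i ≤ 1 - Real.exp (-(K / n)) := fun i => by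
    simp only [hu]
    gcongr
    exact hlK i
  have humono : Monotone u := fun i j hij => by
    simp only [hu]
    gcongr
    exact truncNegLog_antitone K (hanti (by omega))
  have hprod : ∀ i, ∏ j ∈ Finset.range i, (1 - u j) =
      Real.exp (-((∑ j ∈ Finset.range i, l j) / n)) := by
    intro i
    rw [Finset.sum_div, ← Finset.sum_neg_distrib, Real.exp_sum]
    exact Finset.prod_congr rfl fun j _ => by simp only [hu]; ring
  -- The survival probability after i steps dominates θ h one step further along the curve, because
  -- h decays over the step starting at y (i + 1) at least as fast as the rate l i read there.
  have hbase : ∀ i, i + 1 ≤ n → (1 + c)⁻¹ * hillKertz c (y (i + 1)) ≤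
      Real.exp (-((∑ j ∈ Finset.range i, l j) / n)) := by
    intro i
    induction i with
    | zero =>
      intro _
      have := hillKertz_le_one_add c (hyle 1)
      simp only [Finset.range_zero, Finset.sum_empty, zero_div, neg_zero, Real.exp_zero]
      rw [inv_mul_le_one₀ (by linarith)]
      simpa using this
    | succ i ih =>
      intro hi
      have h2 := hillKertz_decay hc (hnn (i + 1 + 1)) (hanti (Nat.le_succ _)) (hyle (i + 1))
      rw [hT (i + 1) (by omega)] at h2
      have h3 : Real.exp (Real.log (y (i + 1)) * (n : ℝ)⁻¹) ≤ Real.exp (-(l i / n)) := by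
        rw [Real.exp_le_exp, div_eq_mul_inv, ← neg_mul]
        have := truncNegLog_le_neg_log K (hpos (i + 1) (by omega))
        have hlog : Real.log (y (i + 1)) ≤ -l i := by simp only [hl]; linarith
        exact mul_le_mul_of_nonneg_right hlog (inv_pos.2 hn').le
      rw [Finset.sum_range_succ, add_div, neg_add, Real.exp_add]
      calc (1 + c)⁻¹ * hillKertz c (y (i + 1 + 1))
          ≤ (1 + c)⁻¹ * (hillKertz c (y (i + 1)) * Real.exp (Real.log (y (i + 1)) * (n : ℝ)⁻¹)) :=
            mul_le_mul_of_nonneg_left h2 (by positivity)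
        _ = ((1 + c)⁻¹ * hillKertz c (y (i + 1))) * Real.exp (Real.log (y (i + 1)) * (n : ℝ)⁻¹) :=
            by ring
        _ ≤ _ := mul_le_mul (ih (by omega)) h3 (Real.exp_pos _).le (Real.exp_pos _).le
  -- One more survival factor, at least e^{-K/n}, realigns the indices.
  have hsurv : ∀ i < n, Real.exp (-(K / n)) * ((1 + c)⁻¹ * hillKertz c (y i)) ≤
      ∏ j ∈ Finset.range i, (1 - u j) := by
    intro i hi
    rw [hprod]
    rcases i with _ | i
    · rw [hy0, hillKertz_one, inv_mul_cancel₀ (by linarith)]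
      simp only [mul_one, Finset.range_zero, Finset.sum_empty, zero_div, neg_zero, Real.exp_zero]
      exact Real.exp_le_one_iff.2 (neg_nonpos.2 (div_pos hK hn').le)
    · rw [Finset.sum_range_succ, add_div, neg_add, Real.exp_add, mul_comm]
      refine mul_le_mul (hbase i (by omega)) ?_ (Real.exp_pos _).le (Real.exp_pos _).le
      gcongr
      exact hlK i
  -- The integral of `truncNegLog a` over [0, 1] is cut at the points y i. On each piece the
  -- integrand is at most m and h at most h(y i), while 1/h integrates to 1/n.
  have hmain : ∀ a, 0 ≤ a → a ≤ K →
      (1 + c)⁻¹ * Real.exp (-(2 * K / n)) * (1 - Real.exp (-a)) ≤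
      ∑ i ∈ Finset.range n, (∏ j ∈ Finset.range i, (1 - u j)) *
        min (u i) (1 - Real.exp (-(a / n))) := by
    intro a ha haK
    have hsum : ∑ i ∈ Finset.range n, ∫ s in y i..y (i + 1), truncNegLog a s =
        -(1 - Real.exp (-a)) := by
      rw [intervalIntegral.sum_integral_adjacent_intervals
        fun i _ => (continuous_truncNegLog a).intervalIntegrable _ _, hy0, hyn,
        intervalIntegral.integral_symm, integral_truncNegLog ha]
    have hsum' : (1 - Real.exp (-a)) =
        ∑ i ∈ Finset.range n, ∫ s in y (i + 1)..y i, truncNegLog a s := by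
      rw [← neg_neg (1 - Real.exp (-a)), ← hsum, ← Finset.sum_neg_distrib]
      exact Finset.sum_congr rfl fun i _ => (intervalIntegral.integral_symm _ _).symm
    rw [hsum', Finset.mul_sum]
    refine Finset.sum_le_sum fun i hi => ?_
    have hin := Finset.mem_range.1 hi
    set m := truncNegLog a (y (i + 1)) with hm
    have hm0 : 0 ≤ m := truncNegLog_nonneg ha (hyle _)
    have hmK : m ≤ K := (truncNegLog_le a _).trans haK
    have hmin : min (u i) (1 - Real.exp (-(a / n))) = 1 - Real.exp (-(m / n)) := by
      have hmono : Monotone fun x : ℝ => 1 - Real.exp (-(x / n)) := fun x z hxz => by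
        simp only
        gcongr
      rw [hm, ← min_truncNegLog haK, hmono.map_min]
    have hle : m / n * Real.exp (-(K / n)) ≤ min (u i) (1 - Real.exp (-(a / n))) := by
      rw [hmin]
      refine le_trans ?_ (mul_exp_neg_le_one_sub_exp_neg (m / n))
      gcongr
    have hint : hillKertz c (y i) * (m / n) ≥ ∫ s in y (i + 1)..y i, truncNegLog a s := by
      have hle2 : ∫ s in y (i + 1)..y i, truncNegLog a s ≤
          ∫ s in y (i + 1)..y i, hillKertz c (y i) * m * (hillKertz c s)⁻¹ := by
        refine intervalIntegral.integral_mono_on (hanti (Nat.le_succ i))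
          ((continuous_truncNegLog a).intervalIntegrable _ _)
          ((continuous_const.mul (continuous_inv_hillKertz hc)).intervalIntegrable _ _)
          fun s hs => ?_
        have h4 : truncNegLog a s ≤ m := truncNegLog_antitone a hs.1
        have h5 : 1 ≤ hillKertz c (y i) * (hillKertz c s)⁻¹ := by
          rw [← div_eq_mul_inv, one_le_div (hillKertz_pos hc s)]
          exact hillKertz_monotone c hs.2
        calc truncNegLog a s ≤ m * 1 := by rw [mul_one]; exact h4
          _ ≤ m * (hillKertz c (y i) * (hillKertz c s)⁻¹) := mul_le_mul_of_nonneg_left h5 hm0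
          _ = _ := by ring
      have h6 : ∫ s in y (i + 1)..y i, (hillKertz c s)⁻¹ = (n : ℝ)⁻¹ := by
        rw [← hT i hin, hillKertzTime, hillKertzTime, intervalIntegral.integral_interval_sub_left
          ((continuous_inv_hillKertz hc).intervalIntegrable _ _)
          ((continuous_inv_hillKertz hc).intervalIntegrable _ _)]
      rw [intervalIntegral.integral_const_mul, h6] at hle2
      rwa [ge_iff_le, div_eq_mul_inv, ← mul_assoc]
    have hexp : Real.exp (-(2 * K / n)) = Real.exp (-(K / n)) * Real.exp (-(K / n)) := by
      rw [← Real.exp_add]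
      congr 1
      ring
    calc (1 + c)⁻¹ * Real.exp (-(2 * K / n)) * ∫ s in y (i + 1)..y i, truncNegLog a s
        ≤ (1 + c)⁻¹ * Real.exp (-(2 * K / n)) * (hillKertz c (y i) * (m / n)) :=
          mul_le_mul_of_nonneg_left hint (by positivity)
      _ = (Real.exp (-(K / n)) * ((1 + c)⁻¹ * hillKertz c (y i))) *
          (m / n * Real.exp (-(K / n))) := by rw [hexp]; ring
      _ ≤ _ := mul_le_mul (hsurv i hin) hle (by positivity)
          (by rw [hprod]; exact (Real.exp_pos _).le)
  have heK : Real.exp (-K) < 1 := Real.exp_lt_one_iff.2 (by linarith)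
  have hcoef : 0 < (1 + c)⁻¹ * Real.exp (-(2 * K / n)) := by positivity
  refine ⟨u, humono, hu0, hu1, fun s hs0 hs1 => ?_⟩
  have hs1' : 0 < 1 - s := by linarith
  -- Chosen so that s = 1 - e^{-a/n} and (1 - s)^n = e^{-a}.
  set a := -(n * Real.log (1 - s)) with ha
  have ha0 : 0 ≤ a := by
    have := Real.log_nonpos hs1'.le (by linarith)
    rw [ha, neg_nonneg]
    exact mul_nonpos_of_nonneg_of_nonpos hn'.le this
  have hsa : 1 - Real.exp (-(a / n)) = s := by
    have : -(a / n) = Real.log (1 - s) := by rw [ha]; field_simp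
    rw [this, Real.exp_log hs1']
    ring
  have hpow : (1 - s) ^ n = Real.exp (-a) := by
    rw [ha, neg_neg, Real.exp_nat_mul, Real.exp_log hs1']
  rw [hpow]
  have hea : Real.exp (-a) ≤ 1 := Real.exp_le_one_iff.2 (by linarith)
  rcases le_total a K with haK | haK
  · have := hmain a ha0 haK
    rw [hsa] at this
    refine le_trans (mul_le_mul_of_nonneg_right ?_ (by linarith)) this
    exact mul_le_of_le_one_right hcoef.le (by linarith [Real.exp_pos (-K)])
  -- Beyond K the left side is bounded by its factor 1 - e^{-K}, and the right side is nondecreasing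
  -- in s, so the case a = K suffices.
  · calc _ ≤ (1 + c)⁻¹ * Real.exp (-(2 * K / n)) * (1 - Real.exp (-K)) :=
          mul_le_of_le_one_right (mul_nonneg hcoef.le (by linarith))
            (by linarith [Real.exp_pos (-a)])
      _ ≤ _ := hmain K hK.le le_rfl
      _ ≤ _ := by
        refine Finset.sum_le_sum fun i _ => mul_le_mul_of_nonneg_left ?_
          (by rw [hprod]; exact (Real.exp_pos _).le)
        refine min_le_min le_rfl ?_
        rw [← hsa]
        gcongr

/-! ### Laws given by a quantile function -/

section QuantileLaw

theorem exists_eq_of_mem_image_Icc {g : ℝ → ℝ} (hc : Continuous g) {a b t : ℝ}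
    (ha : a ∈ Set.Icc (0 : ℝ) 1) (hb : b ∈ Set.Icc (0 : ℝ) 1) (h1 : g a ≤ t) (h2 : t ≤ g b) :
    ∃ x ∈ Set.Icc (0 : ℝ) 1, g x = t := by
  obtain ⟨x, hx, h⟩ := isPreconnected_Icc.intermediate_value ha hb hc.continuousOn ⟨h1, h2⟩
  exact ⟨x, hx, h⟩

instance : IsProbabilityMeasure (volume.restrict (Set.Icc (0 : ℝ) 1)) :=
  ⟨by simp⟩

/-- The law of `g U`, where `U` is uniform on `[0, 1]` and `g` is continuous and strictly
decreasing. -/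
noncomputable def ValueLaw.ofQuantile (g : ℝ → ℝ) (hc : Continuous g) (ha : StrictAnti g)
    (h1 : 0 ≤ g 1) : ValueLaw where
  law := (volume.restrict (Set.Icc (0 : ℝ) 1)).map g
  isProbabilityMeasure := Measure.isProbabilityMeasure_map hc.aemeasurable
  nonneg := by
    rw [Measure.map_apply hc.measurable measurableSet_Iio, Measure.restrict_apply
      (hc.measurable measurableSet_Iio)]
    convert! measure_empty (μ := (volume : Measure ℝ)) using 2
    ext x
    simp only [Set.mem_inter_iff, Set.mem_preimage, Set.mem_Iio, Set.mem_Icc,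
      Set.mem_empty_iff_false, iff_false, not_and, not_le]
    intro hx _
    by_contra h
    linarith [ha.antitone (not_lt.1 h)]
  finite_mean := by
    refine (integrable_map_measure (g := fun x => x) measurable_id.aestronglyMeasurable
      hc.aemeasurable).2 ?_
    exact hc.continuousOn.integrableOn_compact isCompact_Icc
  continuous_cdf := by
    have : IsProbabilityMeasure ((volume.restrict (Set.Icc (0 : ℝ) 1)).map g) :=
      Measure.isProbabilityMeasure_map hc.aemeasurable
    set μ := (volume.restrict (Set.Icc (0 : ℝ) 1)).map g with hμ
    refine continuous_iff_continuousAt.2 fun a => ?_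
    refine continuousAt_iff_continuous_left'_right'.2 ⟨?_, ((cdf μ).right_continuous a).mono
      Set.Ioi_subset_Ici_self⟩
    rw [(monotone_cdf μ).continuousWithinAt_Iio_iff_leftLim_eq]
    have hz : μ {a} = 0 := by
      rw [hμ, Measure.map_apply hc.measurable (measurableSet_singleton a)]
      exact (Set.Subsingleton.preimage Set.subsingleton_singleton ha.injective).measure_zero _
    rw [← measure_cdf μ, StieltjesFunction.measure_singleton, ENNReal.ofReal_eq_zero] at hz
    refine le_antisymm ((monotone_cdf μ).leftLim_le le_rfl) ?_
    linarith
  strictMonoOn_cdf := by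
    have : IsProbabilityMeasure ((volume.restrict (Set.Icc (0 : ℝ) 1)).map g) :=
      Measure.isProbabilityMeasure_map hc.aemeasurable
    set μ := (volume.restrict (Set.Icc (0 : ℝ) 1)).map g with hμ
    -- A point with cdf strictly between 0 and 1 is a value of g on [0, 1]. Two such points s < t,
    -- with preimages x > z, are then separated by the mass of [z, x).
    have hex : ∀ t, 0 < cdf μ t → cdf μ t < 1 → ∃ x ∈ Set.Icc (0 : ℝ) 1, g x = t := by
      intro t h0 h1
      have hm : cdf μ t = (volume.restrict (Set.Icc (0 : ℝ) 1)).real (g ⁻¹' Set.Iic t) := by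
        rw [cdf_eq_real, hμ, map_measureReal_apply hc.measurable measurableSet_Iic]
      have hA : ∃ a ∈ Set.Icc (0 : ℝ) 1, g a ≤ t := by
        by_contra! h
        have : (volume.restrict (Set.Icc (0 : ℝ) 1)).real (g ⁻¹' Set.Iic t) = 0 := by
          rw [measureReal_restrict_apply (hc.measurable measurableSet_Iic)]
          convert! measureReal_empty (μ := (volume : Measure ℝ)) using 2
          ext x
          simp only [Set.mem_inter_iff, Set.mem_preimage, Set.mem_Iic, Set.mem_empty_iff_false,
            iff_false, not_and]
          exact fun hx hx' => absurd hx (not_le.2 (h x hx'))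
        linarith
      have hB : ∃ b ∈ Set.Icc (0 : ℝ) 1, t ≤ g b := by
        by_contra! h
        have : (volume.restrict (Set.Icc (0 : ℝ) 1)).real (g ⁻¹' Set.Iic t) = 1 := by
          have hsub : Set.Icc 0 1 ⊆ g ⁻¹' Set.Iic t := fun x hx => (h x hx).le
          rw [measureReal_restrict_apply (hc.measurable measurableSet_Iic),
            Set.inter_eq_right.2 hsub]
          simp
        linarith
      obtain ⟨a, ha', hat⟩ := hA
      obtain ⟨b, hb', hbt⟩ := hB
      exact exists_eq_of_mem_image_Icc hc ha' hb' hat hbt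
    intro s hs t ht hst
    obtain ⟨x, hx, hxs⟩ := hex s hs.1 hs.2
    obtain ⟨z, hz, hzt⟩ := hex t ht.1 ht.2
    have hzx : z < x := by
      rw [← ha.lt_iff_gt, hxs, hzt]
      exact hst
    have hd : cdf μ t - cdf μ s = μ.real (Set.Ioc s t) := by
      rw [cdf_eq_real, cdf_eq_real, ← Set.Iic_sdiff_Iic, measureReal_sdiff
        (Set.Iic_subset_Iic.2 hst.le) measurableSet_Iic]
    have hpos : 0 < μ.real (Set.Ioc s t) := by
      rw [hμ, map_measureReal_apply hc.measurable measurableSet_Ioc, measureReal_restrict_apply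
        (hc.measurable measurableSet_Ioc)]
      refine lt_of_lt_of_le (b := volume.real (Set.Ico z x)) ?_ (measureReal_mono ?_ ?_)
      · simp [hzx]
      · intro w hw
        refine ⟨⟨?_, ?_⟩, hz.1.trans hw.1, hw.2.le.trans hx.2⟩
        · rw [← hxs]
          exact ha hw.2
        · rw [← hzt]
          exact ha.antitone hw.1
      · exact ((measure_mono Set.inter_subset_right).trans_lt (by simp)).ne
    linarith

variable {g : ℝ → ℝ} (hc : Continuous g) (ha : StrictAnti g) (h1 : 0 ≤ g 1)

theorem ValueLaw.integral_ofQuantile {f : ℝ → ℝ} (hf : Continuous f) :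
    ∫ x, f x ∂(ValueLaw.ofQuantile g hc ha h1).law = ∫ x in (0 : ℝ)..1, f (g x) := by
  rw [intervalIntegral.integral_of_le zero_le_one, ← integral_Icc_eq_integral_Ioc]
  exact integral_map hc.aemeasurable hf.aestronglyMeasurable

theorem ValueLaw.tail_ofQuantile (t : ℝ) :
    (ValueLaw.ofQuantile g hc ha h1).tail t = volume.real ({x | t < g x} ∩ Set.Icc 0 1) := by
  show ((volume.restrict (Set.Icc (0 : ℝ) 1)).map g).real (Set.Ioi t) = _
  rw [map_measureReal_apply hc.measurable measurableSet_Ioi, measureReal_restrict_apply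
    (hc.measurable measurableSet_Ioi)]
  rfl

theorem integral_mul_exp_neg {N : ℝ} (b : ℝ) :
    ∫ x in (0 : ℝ)..b, N * Real.exp (-(N * x)) = 1 - Real.exp (-(N * b)) := by
  have hd : ∀ x ∈ Set.uIcc 0 b, HasDerivAt (fun x => -Real.exp (-(N * x)))
      (N * Real.exp (-(N * x))) x := by
    intro x _
    convert! (((hasDerivAt_id x).const_mul N).neg.exp).neg using 1
    simp
    ring
  rw [intervalIntegral.integral_eq_sub_of_hasDerivAt hd
    (Continuous.intervalIntegrable (by fun_prop) _ _)]
  simp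
  ring

/-- Layer cake under the density N e^{-Nx}: within [0, 1] the set where g > t lies in [0, G(t)],
since g decreases, and has mass at most 1 - e^{-N G(t)}. Finally (1 - p G)^n ≤ e^{-N G}. -/
theorem ValueLaw.le_integral_one_sub_exp_tail {N : ℝ} (hN : 0 < N) {p : ℝ} (hp0 : 0 ≤ p)
    (hp1 : p ≤ 1) {n : ℕ} (hNp : N = n * p) :
    ∫ x in (0 : ℝ)..1, g x * (N * Real.exp (-(N * x))) ≤
      ∫ t in Set.Ioi (0 : ℝ),
        (1 - (1 - p * (ValueLaw.ofQuantile g hc ha h1).tail t) ^ n) := by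
  set F := ValueLaw.ofQuantile g hc ha h1
  have hdens : Measurable fun x : ℝ => Real.toNNReal (N * Real.exp (-(N * x))) := by fun_prop
  have hcoe : ∀ x, ((Real.toNNReal (N * Real.exp (-(N * x))) : NNReal) : ℝ) =
      N * Real.exp (-(N * x)) := fun x => Real.coe_toNNReal _ (by positivity)
  set ν := (volume.restrict (Set.Icc (0 : ℝ) 1)).withDensity
    (fun x => (Real.toNNReal (N * Real.exp (-(N * x))) : ENNReal)) with hν
  have hgint : Integrable g ν := by
    rw [hν, integrable_withDensity_iff_integrable_smul hdens]
    refine Continuous.integrableOn_Icc ?_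
    simp only [NNReal.smul_def, hcoe]
    fun_prop
  have hreal : ∀ A : Set ℝ, MeasurableSet A →
      ν.real A = ∫ x in A ∩ Set.Icc 0 1, N * Real.exp (-(N * x)) := by
    intro A hA
    have h2 := integral_withDensity_eq_integral_smul (μ := volume.restrict (Set.Icc (0 : ℝ) 1))
      hdens (A.indicator fun _ => (1 : ℝ))
    rw [← hν, integral_indicator_const _ hA, smul_eq_mul, mul_one] at h2
    rw [h2, ← Measure.restrict_restrict hA, ← integral_indicator hA]
    congr 1
    ext x
    by_cases hx : x ∈ A <;> simp [hx, NNReal.smul_def, hcoe]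
  have hgnn : 0 ≤ᵐ[ν] g := by
    refine (withDensity_absolutelyContinuous _ _).ae_le ?_
    filter_upwards [ae_restrict_mem measurableSet_Icc] with x hx
    exact h1.trans (ha.antitone hx.2)
  have hlay := hgint.integral_eq_integral_meas_lt hgnn
  have hlhs : ∫ x, g x ∂ν = ∫ x in (0 : ℝ)..1, g x * (N * Real.exp (-(N * x))) := by
    rw [hν, integral_withDensity_eq_integral_smul hdens,
      intervalIntegral.integral_of_le zero_le_one, ← integral_Icc_eq_integral_Ioc]
    congr 1
    ext x
    rw [NNReal.smul_def, hcoe, smul_eq_mul, mul_comm]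
  rw [← hlhs, hlay]
  refine integral_mono_of_nonneg (Eventually.of_forall fun t => measureReal_nonneg)
    (F.integrableOn_one_sub_pow_tail hp0 hp1 n) (Eventually.of_forall fun t => ?_)
  have hA : MeasurableSet {x | t < g x} := hc.measurable measurableSet_Ioi
  have hsub : {x | t < g x} ∩ Set.Icc 0 1 ⊆ Set.Icc 0 (F.tail t) := by
    intro x hx
    refine ⟨hx.2.1, ?_⟩
    rw [ValueLaw.tail_ofQuantile]
    have h3 : volume.real (Set.Icc 0 x) ≤ volume.real ({x | t < g x} ∩ Set.Icc 0 1) := by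
      refine measureReal_mono (fun w hw => ⟨?_, hw.1, hw.2.trans hx.2.2⟩) ?_
      · exact lt_of_lt_of_le hx.1 (ha.antitone hw.2)
      · exact ((measure_mono Set.inter_subset_right).trans_lt (by simp)).ne
    simpa [hx.2.1] using h3
  have h4 : ν.real {x | t < g x} ≤ 1 - Real.exp (-(N * F.tail t)) := by
    rw [hreal _ hA, ← integral_mul_exp_neg (N := N) (F.tail t),
      intervalIntegral.integral_of_le (F.tail_nonneg t), ← integral_Icc_eq_integral_Ioc]
    refine setIntegral_mono_set (Continuous.integrableOn_Icc (by fun_prop))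
      (Eventually.of_forall fun x => ?_) hsub.eventuallyLE
    show 0 ≤ N * Real.exp (-(N * x))
    positivity
  refine h4.trans ?_
  have h5 : (1 - p * F.tail t) ^ n ≤ Real.exp (-(N * F.tail t)) := by
    have h6 : 0 ≤ 1 - p * F.tail t := by
      have := mul_le_one₀ hp1 (F.tail_nonneg t) (F.tail_le_one t)
      linarith
    calc (1 - p * F.tail t) ^ n ≤ Real.exp (-(p * F.tail t)) ^ n :=
          pow_le_pow_left₀ h6 (Real.one_sub_le_exp_neg _) n
      _ = _ := by
        rw [← Real.exp_nat_mul, hNp]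
        congr 1
        ring
  show 1 - Real.exp (-(N * F.tail t)) ≤ 1 - (1 - p * F.tail t) ^ n
  linarith

end QuantileLaw

/-! ### The worst-case law -/

/-- The value, in the continuous-time limit problem, of the state in which the Hill–Kertz curve is
at height `y`. -/
noncomputable def hillKertzValue (c y : ℝ) : ℝ := ∫ s in (0 : ℝ)..y, ((hillKertz c s)⁻¹) ^ 2

theorem hasDerivAt_hillKertzValue {c : ℝ} (hc : 0 < c) (y : ℝ) :
    HasDerivAt (hillKertzValue c) (((hillKertz c y)⁻¹) ^ 2) y :=
  (((continuous_inv_hillKertz hc).pow 2).integral_hasStrictDerivAt 0 y).hasDerivAt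

theorem continuous_hillKertzValue {c : ℝ} (hc : 0 < c) : Continuous (hillKertzValue c) :=
  continuous_iff_continuousAt.2 fun y => (hasDerivAt_hillKertzValue hc y).continuousAt

theorem hillKertzValue_strictMono {c : ℝ} (hc : 0 < c) : StrictMono (hillKertzValue c) := by
  refine strictMono_of_deriv_pos fun s => ?_
  rw [(hasDerivAt_hillKertzValue hc s).deriv]
  exact pow_pos (inv_pos.2 (hillKertz_pos hc s)) 2

theorem hillKertzValue_zero (c : ℝ) : hillKertzValue c 0 = 0 := intervalIntegral.integral_same

theorem hillKertzValue_sub {c : ℝ} (hc : 0 < c) (a b : ℝ) :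
    hillKertzValue c b - hillKertzValue c a = ∫ s in a..b, ((hillKertz c s)⁻¹) ^ 2 := by
  exact intervalIntegral.integral_interval_sub_left
    (((continuous_inv_hillKertz hc).pow 2).intervalIntegrable _ _)
    (((continuous_inv_hillKertz hc).pow 2).intervalIntegrable _ _)

theorem hillKertzTime_sub {c : ℝ} (hc : 0 < c) (a b : ℝ) :
    hillKertzTime c b - hillKertzTime c a = ∫ s in a..b, (hillKertz c s)⁻¹ := by
  rw [hillKertzTime, hillKertzTime, intervalIntegral.integral_interval_sub_left
    ((continuous_inv_hillKertz hc).intervalIntegrable _ _)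
    ((continuous_inv_hillKertz hc).intervalIntegrable _ _)]

/-- With respect to T, V has slope 1/h. The crude bound h ≥ c controls the discretisation error; the
matching lower bound, with h at the upper endpoint, gives the Bellman step. -/
theorem hillKertzValue_sub_le {c : ℝ} (hc : 0 < c) {a b : ℝ} (h : a ≤ b) :
    hillKertzValue c b - hillKertzValue c a ≤ c⁻¹ * (hillKertzTime c b - hillKertzTime c a) := by
  rw [hillKertzValue_sub hc, hillKertzTime_sub hc, ← intervalIntegral.integral_const_mul]
  refine intervalIntegral.integral_mono_on h
    (((continuous_inv_hillKertz hc).pow 2).intervalIntegrable _ _)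
    ((continuous_const.mul (continuous_inv_hillKertz hc)).intervalIntegrable _ _) fun s _ => ?_
  have h1 : (hillKertz c s)⁻¹ ≤ c⁻¹ := inv_anti₀ hc (le_hillKertz c s)
  have h2 : 0 < (hillKertz c s)⁻¹ := inv_pos.2 (hillKertz_pos hc s)
  rw [sq]
  exact mul_le_mul_of_nonneg_right h1 h2.le

theorem le_hillKertzValue_sub {c : ℝ} (hc : 0 < c) {a b : ℝ} (h : a ≤ b) :
    (hillKertz c b)⁻¹ * (hillKertzTime c b - hillKertzTime c a) ≤
      hillKertzValue c b - hillKertzValue c a := by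
  rw [hillKertzValue_sub hc, hillKertzTime_sub hc, ← intervalIntegral.integral_const_mul]
  refine intervalIntegral.integral_mono_on h
    ((continuous_const.mul (continuous_inv_hillKertz hc)).intervalIntegrable _ _)
    (((continuous_inv_hillKertz hc).pow 2).intervalIntegrable _ _) fun s hs => ?_
  have h1 : (hillKertz c b)⁻¹ ≤ (hillKertz c s)⁻¹ :=
    inv_anti₀ (hillKertz_pos hc s) (hillKertz_monotone c hs.2)
  have h2 : 0 < (hillKertz c s)⁻¹ := inv_pos.2 (hillKertz_pos hc s)
  rw [sq]
  exact mul_le_mul_of_nonneg_right h1 h2.le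

/-- (s + c)V - s/h is a primitive of V: the remaining terms of its derivative are (s - s ln s +
c)/h² - 1/h, which cancel by the very form of h. -/
theorem integral_hillKertzValue {c : ℝ} (hc : 0 < c) :
    ∫ y in (0 : ℝ)..1, hillKertzValue c y = (1 + c) * hillKertzValue c 1 - (1 + c)⁻¹ := by
  have hcont : Continuous fun s =>
      s * hillKertzValue c s - s * (hillKertz c s)⁻¹ + c * hillKertzValue c s :=
    ((continuous_id.mul (continuous_hillKertzValue hc)).sub
      (continuous_id.mul (continuous_inv_hillKertz hc))).add
      (continuous_const.mul (continuous_hillKertzValue hc))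
  have hd : ∀ s ∈ Set.Ioo (0 : ℝ) 1, HasDerivAt (fun s =>
      s * hillKertzValue c s - s * (hillKertz c s)⁻¹ + c * hillKertzValue c s)
      (hillKertzValue c s) s := by
    intro s hs
    have hne := (hillKertz_pos hc s).ne'
    have hv := hasDerivAt_hillKertzValue hc s
    have hh := (hasDerivAt_hillKertz c hs.1 hs.2).inv hne
    convert! (((hasDerivAt_id s).mul hv).sub ((hasDerivAt_id s).mul hh)).add (hv.const_mul c)
      using 1
    have hform := hillKertz_of_mem c hs.1.le hs.2.le
    simp only [id, Pi.inv_apply]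
    field_simp
    rw [hform]
    ring
  rw [intervalIntegral.integral_eq_sub_of_hasDerivAt_of_le zero_le_one hcont.continuousOn hd
    ((continuous_hillKertzValue hc).intervalIntegrable _ _), hillKertz_one, hillKertzValue_zero]
  ring

theorem integral_tent {δ : ℝ} (h0 : 0 ≤ δ) (h1 : δ ≤ 1) :
    ∫ x in (0 : ℝ)..1, max (δ - x) 0 = δ ^ 2 / 2 := by
  have hc : Continuous fun x : ℝ => max (δ - x) 0 := by fun_prop
  rw [← intervalIntegral.integral_add_adjacent_intervals (hc.intervalIntegrable 0 δ)
    (hc.intervalIntegrable δ 1)]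
  have h2 : ∫ x in (0 : ℝ)..δ, max (δ - x) 0 = ∫ x in (0 : ℝ)..δ, (δ - x) := by
    refine intervalIntegral.integral_congr fun x hx => ?_
    rw [Set.uIcc_of_le h0] at hx
    exact max_eq_left (sub_nonneg.2 hx.2)
  have h3 : ∫ x in δ..1, max (δ - x) 0 = ∫ x in δ..1, (0 : ℝ) := by
    refine intervalIntegral.integral_congr fun x hx => ?_
    rw [Set.uIcc_of_le h1] at hx
    exact max_eq_right (sub_nonpos.2 hx.1)
  rw [h2, h3, intervalIntegral.integral_sub (by simp) (by simp)]
  simp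
  ring

/-- The quantile function of the worst-case law: the continuous-time value along the Hill–Kertz
curve, plus a narrow tent of expectation `1 / ((1 + c) N)` near the top quantile. -/
noncomputable def hardQuantile (c N δ x : ℝ) : ℝ :=
  hillKertzValue c (Real.exp (-(N * x))) + 2 / ((1 + c) * N * δ ^ 2) * max (δ - x) 0

theorem continuous_hardQuantile {c : ℝ} (hc : 0 < c) (N δ : ℝ) :
    Continuous (hardQuantile c N δ) := by
  have := continuous_hillKertzValue hc
  unfold hardQuantile
  fun_prop

theorem hardQuantile_strictAnti {c N : ℝ} (hc : 0 < c) (hN : 0 < N) (δ : ℝ) :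
    StrictAnti (hardQuantile c N δ) := by
  intro x z h
  refine add_lt_add_of_lt_of_le (hillKertzValue_strictMono hc ?_) ?_
  · rw [Real.exp_lt_exp]
    have := mul_lt_mul_of_pos_left h hN
    linarith
  · refine mul_le_mul_of_nonneg_left (max_le_max (by linarith) le_rfl) (by positivity)

theorem hardQuantile_nonneg {c N : ℝ} (hc : 0 < c) (hN : 0 < N) (δ x : ℝ) :
    0 ≤ hardQuantile c N δ x := by
  refine add_nonneg ?_ (by positivity)
  rw [← hillKertzValue_zero c]
  exact (hillKertzValue_strictMono hc).monotone (Real.exp_pos _).le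

/-- With s = e^{-Nx} and an integration by parts, the full integral becomes that of (-ln s)V'(s) =
h'/h² over [y, 1], which is 1/h(y) - 1/h(1). -/
theorem integral_hillKertzValue_excess_le {c N : ℝ} (hc : 0 < c) (hN : 0 < N) {y : ℝ}
    (hy0 : 0 < y) (hy1 : y ≤ 1) :
    N * ∫ x in (0 : ℝ)..1, max (hillKertzValue c (Real.exp (-(N * x))) - hillKertzValue c y) 0 ≤
      (hillKertz c y)⁻¹ - (1 + c)⁻¹ := by
  have hcv := continuous_hillKertzValue hc
  have hcont : Continuous fun x : ℝ =>
      max (hillKertzValue c (Real.exp (-(N * x))) - hillKertzValue c y) 0 := by fun_prop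
  set L := -Real.log y / N with hL
  have hL0 : 0 ≤ L := div_nonneg (neg_nonneg.2 (Real.log_nonpos hy0.le hy1)) hN.le
  have hNL : N * L = -Real.log y := by rw [hL]; field_simp
  have hmono := (hillKertzValue_strictMono hc).monotone
  -- The excess vanishes beyond L, but L may exceed 1; enlarging the range to max 1 L covers both
  -- cases.
  have h1 : ∫ x in (0 : ℝ)..1,
      max (hillKertzValue c (Real.exp (-(N * x))) - hillKertzValue c y) 0 ≤
      ∫ x in (0 : ℝ)..max 1 L,
        max (hillKertzValue c (Real.exp (-(N * x))) - hillKertzValue c y) 0 := by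
    rw [← intervalIntegral.integral_add_adjacent_intervals (hcont.intervalIntegrable 0 1)
      (hcont.intervalIntegrable 1 (max 1 L))]
    have : 0 ≤ ∫ x in (1 : ℝ)..max 1 L,
        max (hillKertzValue c (Real.exp (-(N * x))) - hillKertzValue c y) 0 :=
      intervalIntegral.integral_nonneg (le_max_left _ _) fun _ _ => le_max_right _ _
    linarith
  have h2 : ∫ x in L..max 1 L,
      max (hillKertzValue c (Real.exp (-(N * x))) - hillKertzValue c y) 0 =
      ∫ x in L..max 1 L, (0 : ℝ) := by
    refine intervalIntegral.integral_congr fun x hx => ?_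
    rw [Set.uIcc_of_le (le_max_right _ _)] at hx
    refine max_eq_right (sub_nonpos.2 (hmono ?_))
    rw [← Real.le_log_iff_exp_le hy0]
    have := mul_le_mul_of_nonneg_left hx.1 hN.le
    linarith
  have h3 : ∫ x in (0 : ℝ)..L,
      max (hillKertzValue c (Real.exp (-(N * x))) - hillKertzValue c y) 0 =
      ∫ x in (0 : ℝ)..L, (hillKertzValue c (Real.exp (-(N * x))) - hillKertzValue c y) := by
    refine intervalIntegral.integral_congr fun x hx => ?_
    rw [Set.uIcc_of_le hL0] at hx
    refine max_eq_left (sub_nonneg.2 (hmono ?_))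
    rw [← Real.log_le_iff_le_exp hy0]
    have := mul_le_mul_of_nonneg_left hx.2 hN.le
    linarith
  have h4 : ∫ x in (0 : ℝ)..L,
      N * (hillKertzValue c (Real.exp (-(N * x))) - hillKertzValue c y) =
      (hillKertz c y)⁻¹ - (1 + c)⁻¹ := by
    have hci := continuous_inv_hillKertz hc
    have hcH : Continuous fun x : ℝ =>
        (hillKertzValue c (Real.exp (-(N * x))) - hillKertzValue c y) * (N * x) +
          (hillKertz c (Real.exp (-(N * x))))⁻¹ :=
      Continuous.add (by fun_prop) (hci.comp (by fun_prop))
    have hd : ∀ x ∈ Set.Ioo 0 L, HasDerivAt (fun x : ℝ =>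
        (hillKertzValue c (Real.exp (-(N * x))) - hillKertzValue c y) * (N * x) +
          (hillKertz c (Real.exp (-(N * x))))⁻¹)
        (N * (hillKertzValue c (Real.exp (-(N * x))) - hillKertzValue c y)) x := by
      intro x hx
      have hNx : HasDerivAt (fun x : ℝ => N * x) N x := by
        simpa using (hasDerivAt_id x).const_mul N
      have hlt : Real.exp (-(N * x)) < 1 := Real.exp_lt_one_iff.2 (by
        have := mul_pos hN hx.1
        linarith)
      have hne := (hillKertz_pos hc (Real.exp (-(N * x)))).ne'
      have hE : HasDerivAt (fun x : ℝ => Real.exp (-(N * x))) (Real.exp (-(N * x)) * -N) x :=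
        hNx.neg.exp
      have hv : HasDerivAt (fun x : ℝ => hillKertzValue c (Real.exp (-(N * x))))
          (((hillKertz c (Real.exp (-(N * x))))⁻¹) ^ 2 * (Real.exp (-(N * x)) * -N)) x :=
        HasDerivAt.comp (h₂ := hillKertzValue c) x
          (hasDerivAt_hillKertzValue hc (Real.exp (-(N * x)))) hE
      have hh : HasDerivAt (fun x : ℝ => hillKertz c (Real.exp (-(N * x))))
          (-Real.log (Real.exp (-(N * x))) * (Real.exp (-(N * x)) * -N)) x :=
        HasDerivAt.comp (h₂ := hillKertz c) x
          (hasDerivAt_hillKertz c (Real.exp_pos (-(N * x))) hlt) hE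
      convert! ((hv.sub_const (hillKertzValue c y)).mul hNx).add (hh.inv hne) using 1
      simp only [Real.log_exp]
      field_simp
      ring
    rw [intervalIntegral.integral_eq_sub_of_hasDerivAt_of_le hL0
      hcH.continuousOn hd (Continuous.intervalIntegrable (by fun_prop) _ _),
      hNL, neg_neg, Real.exp_log hy0]
    simp [hillKertz_one]
  rw [intervalIntegral.integral_const_mul] at h4
  rw [← intervalIntegral.integral_add_adjacent_intervals (hcont.intervalIntegrable 0 L)
    (hcont.intervalIntegrable L (max 1 L)), h2, h3, intervalIntegral.integral_zero, add_zero] at h1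
  calc _ ≤ _ := mul_le_mul_of_nonneg_left h1 hN.le
    _ = _ := h4

/-- The tent, scaled to contribute exactly 1/(1 + c) after multiplication by N, makes up the deficit
in the bound for V alone. -/
theorem integral_hardQuantile_excess_le {c N δ : ℝ} (hc : 0 < c) (hN : 0 < N) (hδ0 : 0 < δ)
    (hδ1 : δ ≤ 1) {y k : ℝ} (hy0 : 0 < y) (hy1 : y ≤ 1) (hk : hillKertzValue c y ≤ k) :
    N * ∫ x in (0 : ℝ)..1, max (hardQuantile c N δ x - k) 0 ≤ (hillKertz c y)⁻¹ := by
  have hcv := continuous_hillKertzValue hc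
  have hcq := continuous_hardQuantile hc N δ
  have h1 : ∫ x in (0 : ℝ)..1, max (hardQuantile c N δ x - k) 0 ≤
      ∫ x in (0 : ℝ)..1, (max (hillKertzValue c (Real.exp (-(N * x))) - hillKertzValue c y) 0 +
        2 / ((1 + c) * N * δ ^ 2) * max (δ - x) 0) := by
    refine intervalIntegral.integral_mono_on zero_le_one
      (Continuous.intervalIntegrable (by fun_prop) _ _)
      (Continuous.intervalIntegrable (by fun_prop) _ _) fun x _ => ?_
    have h2 : 0 ≤ 2 / ((1 + c) * N * δ ^ 2) * max (δ - x) 0 := by positivity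
    refine max_le ?_ (add_nonneg (le_max_right _ _) h2)
    have := le_max_left (hillKertzValue c (Real.exp (-(N * x))) - hillKertzValue c y) 0
    unfold hardQuantile
    linarith
  rw [intervalIntegral.integral_add (Continuous.intervalIntegrable (by fun_prop) _ _)
    (Continuous.intervalIntegrable (by fun_prop) _ _), intervalIntegral.integral_const_mul,
    integral_tent hδ0.le hδ1] at h1
  have h3 := integral_hillKertzValue_excess_le hc hN hy0 hy1
  have h4 : N * (2 / ((1 + c) * N * δ ^ 2) * (δ ^ 2 / 2)) = (1 + c)⁻¹ := by field_simp
  have h5 := mul_le_mul_of_nonneg_left h1 hN.le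
  rw [mul_add, h4] at h5
  linarith

/-- The substitution s = e^{-Nx} gives ∫ V over [e^{-N}, 1]. The tent lives on [0, δ], where the
factor e^{-Nx} is at least e^{-Nδ}. -/
theorem le_integral_hardQuantile {c N δ : ℝ} (hc : 0 < c) (hN : 0 < N) (hδ0 : 0 < δ)
    (hδ1 : δ ≤ 1) :
    (1 + c) * hillKertzValue c 1 - (1 + c)⁻¹ -
        (∫ s in (0 : ℝ)..Real.exp (-N), hillKertzValue c s) + Real.exp (-(N * δ)) * (1 + c)⁻¹ ≤
      ∫ x in (0 : ℝ)..1, hardQuantile c N δ x * (N * Real.exp (-(N * x))) := by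
  have hcv := continuous_hillKertzValue hc
  have hsplit : ∀ x, hardQuantile c N δ x * (N * Real.exp (-(N * x))) =
      hillKertzValue c (Real.exp (-(N * x))) * (N * Real.exp (-(N * x))) +
      2 / ((1 + c) * δ ^ 2) * (max (δ - x) 0 * Real.exp (-(N * x))) := by
    intro x
    unfold hardQuantile
    field_simp
  simp_rw [hsplit]
  rw [intervalIntegral.integral_add (Continuous.intervalIntegrable (by fun_prop) _ _)
    (Continuous.intervalIntegrable (by fun_prop) _ _), intervalIntegral.integral_const_mul]
  have h1 : ∫ x in (0 : ℝ)..1,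
      hillKertzValue c (Real.exp (-(N * x))) * (N * Real.exp (-(N * x))) =
      (1 + c) * hillKertzValue c 1 - (1 + c)⁻¹ -
        ∫ s in (0 : ℝ)..Real.exp (-N), hillKertzValue c s := by
    have hd : ∀ x ∈ Set.uIcc (0 : ℝ) 1, HasDerivAt
        (fun x => -∫ s in (0 : ℝ)..Real.exp (-(N * x)), hillKertzValue c s)
        (hillKertzValue c (Real.exp (-(N * x))) * (N * Real.exp (-(N * x)))) x := by
      intro x _
      have hNx : HasDerivAt (fun x : ℝ => N * x) N x := by
        simpa using (hasDerivAt_id x).const_mul N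
      have hE : HasDerivAt (fun x : ℝ => Real.exp (-(N * x))) (Real.exp (-(N * x)) * -N) x :=
        hNx.neg.exp
      convert! ((hcv.integral_hasStrictDerivAt 0 (Real.exp (-(N * x)))).hasDerivAt.comp x
        hE).neg using 1
      ring
    rw [intervalIntegral.integral_eq_sub_of_hasDerivAt hd
      (Continuous.intervalIntegrable (by fun_prop) _ _), ← integral_hillKertzValue hc]
    simp
    ring
  have h2 : Real.exp (-(N * δ)) * (δ ^ 2 / 2) ≤
      ∫ x in (0 : ℝ)..1, max (δ - x) 0 * Real.exp (-(N * x)) := by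
    rw [← integral_tent hδ0.le hδ1, ← intervalIntegral.integral_const_mul]
    refine intervalIntegral.integral_mono_on zero_le_one
      (Continuous.intervalIntegrable (by fun_prop) _ _)
      (Continuous.intervalIntegrable (by fun_prop) _ _) fun x _ => ?_
    rcases le_total x δ with h | h
    · rw [mul_comm]
      refine mul_le_mul_of_nonneg_left ?_ (le_max_right _ _)
      gcongr
    · rw [max_eq_right (sub_nonpos.2 h)]
      simp
  have h3 := mul_le_mul_of_nonneg_left h2 (show 0 ≤ 2 / ((1 + c) * δ ^ 2) by positivity)
  have h4 : 2 / ((1 + c) * δ ^ 2) * (Real.exp (-(N * δ)) * (δ ^ 2 / 2)) =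
      Real.exp (-(N * δ)) * (1 + c)⁻¹ := by field_simp
  rw [h1]
  linarith

/-- A lower bound, in units of `payFraction p ζ / p`, for the clairvoyant benchmark of the
worst-case law. -/
noncomputable def hardOptBound (c p : ℝ) (n : ℕ) : ℝ :=
  (1 + c) * hillKertzValue c 1 - (1 + c)⁻¹ -
    (∫ s in (0 : ℝ)..Real.exp (-(n * p)), hillKertzValue c s) +
    Real.exp (-(n * p * ((n : ℝ) ^ 2)⁻¹)) * (1 + c)⁻¹

theorem exists_hard_instance {c : ℝ} (hc : 0 < c) (h1 : hillKertzTime c 1 = 1) {n : ℕ}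
    (hn : n ≠ 0) {p : unitInterval} (hp : 0 < p) (hp1 : p < 1) {ζ : ℝ} (hζ : 0 ≤ ζ)
    (hζ1 : ζ ≤ 1) :
    ∃ F : ValueLaw, payFraction p ζ / p * hardOptBound c p n ≤ optValue p ζ n F ∧
      ∀ τ : Fin n → ℝ, thresholdValue p ζ F τ ≤
        payFraction p ζ / p * (hillKertzValue c 1 + c⁻¹ * (n : ℝ)⁻¹) := by
  have hp' : (0 : ℝ) < p := hp
  have hn' : (0 : ℝ) < n := by exact_mod_cast Nat.pos_of_ne_zero hn
  have hN : (0 : ℝ) < n * p := mul_pos hn' hp'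
  have hδ0 : (0 : ℝ) < ((n : ℝ) ^ 2)⁻¹ := by positivity
  have hδ1 : ((n : ℝ) ^ 2)⁻¹ ≤ 1 := by
    refine inv_le_one_of_one_le₀ (one_le_pow₀ ?_)
    exact_mod_cast Nat.one_le_iff_ne_zero.2 hn
  -- The width n⁻² makes Nδ = p/n vanish, so the benchmark keeps the full weight of the tent in the
  -- limit.
  set δ := ((n : ℝ) ^ 2)⁻¹
  have hgc := continuous_hardQuantile hc (n * p) δ
  have hga := hardQuantile_strictAnti hc hN δ
  have hg1 := hardQuantile_nonneg hc hN δ 1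
  have hpay := payFraction_pos hp1 hζ
  refine ⟨ValueLaw.ofQuantile _ hgc hga hg1, ?_, fun τ => ?_⟩
  · rw [optValue_eq p hp hζ hζ1]
    refine mul_le_mul_of_nonneg_left ?_ (div_pos hpay hp').le
    exact (le_integral_hardQuantile hc hN hδ0 hδ1).trans
      (ValueLaw.le_integral_one_sub_exp_tail hgc hga hg1 hN hp'.le p.2.2 rfl)
  · obtain ⟨y, hanti, hy0, hyn, -, hnn, hpos, hT⟩ := exists_hillKertz_partition hc h1 hn
    have hyle : ∀ i, y i ≤ 1 := fun i => hy0 ▸ hanti (Nat.zero_le i)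
    have key := thresholdValue_le hp hζ (ValueLaw.ofQuantile _ hgc hga hg1)
      -- The excess bound at y i needs a level k ≥ V(y i), whereas the recursion uses the
      -- continuation value at i + 1. The constant slack c⁻¹/n covers the drop of V over one step
      -- and cancels in W i - W (i + 1).
      (W := fun i => hillKertzValue c (y i) + c⁻¹ * (n : ℝ)⁻¹) ?_ (fun i hi => ?_) τ
    · simpa only [hy0] using key
    · simp only [hyn, hillKertzValue_zero]
      positivity
    · have hstep := hanti (Nat.le_succ i)
      have hup := hillKertzValue_sub_le hc hstep
      have hlow := le_hillKertzValue_sub hc hstep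
      rw [Nat.succ_eq_add_one, hT i hi] at hup hlow
      have hex := integral_hardQuantile_excess_le hc hN hδ0 hδ1 (hpos i hi) (hyle i)
        (k := hillKertzValue c (y (i + 1)) + c⁻¹ * (n : ℝ)⁻¹) (by linarith)
      rw [ValueLaw.integral_ofQuantile hgc hga hg1
        (f := fun x => max (x - (hillKertzValue c (y (i + 1)) + c⁻¹ * (n : ℝ)⁻¹)) 0) (by fun_prop)]
      have h3 := mul_le_mul_of_nonneg_right hex (inv_pos.2 hn').le
      rw [mul_assoc (n : ℝ), mul_comm (n : ℝ), mul_assoc _ (n : ℝ), mul_inv_cancel₀ hn'.ne',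
        mul_one] at h3
      linarith

theorem tendsto_hardOptBound {c : ℝ} (hc : 0 < c) {p : ℝ} (hp : 0 < p) :
    Tendsto (hardOptBound c p) atTop (𝓝 ((1 + c) * hillKertzValue c 1)) := by
  have hcast := tendsto_natCast_atTop_atTop (R := ℝ)
  have h1 : Tendsto (fun n : ℕ => Real.exp (-(n * p))) atTop (𝓝 0) :=
    Real.tendsto_exp_neg_atTop_nhds_zero.comp (hcast.atTop_mul_const hp)
  have h2 : Tendsto (fun n : ℕ => ∫ s in (0 : ℝ)..Real.exp (-(n * p)), hillKertzValue c s) atTop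
      (𝓝 0) := by
    have h3 : Continuous fun b => ∫ s in (0 : ℝ)..b, hillKertzValue c s :=
      intervalIntegral.continuous_primitive
        (fun a b => (continuous_hillKertzValue hc).intervalIntegrable a b) 0
    have h4 := (h3.tendsto 0).comp h1
    rwa [intervalIntegral.integral_same] at h4
  have h5 : Tendsto (fun n : ℕ => Real.exp (-(n * p * ((n : ℝ) ^ 2)⁻¹))) atTop (𝓝 1) := by
    have h6 : Tendsto (fun n : ℕ => -(p * (n : ℝ)⁻¹)) atTop (𝓝 (-(p * 0))) :=
      ((tendsto_inv_atTop_zero.comp hcast).const_mul p).neg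
    have h7 := (Real.continuous_exp.tendsto _).comp h6
    rw [mul_zero, neg_zero, Real.exp_zero] at h7
    refine h7.congr' ?_
    filter_upwards [eventually_ne_atTop 0] with n hn
    have : (n : ℝ) ≠ 0 := by exact_mod_cast hn
    simp only [Function.comp]
    congr 1
    field_simp
  have h8 := ((tendsto_const_nhds (x := (1 + c) * hillKertzValue c 1 - (1 + c)⁻¹)).sub h2).add
    (h5.mul_const (1 + c)⁻¹)
  unfold hardOptBound
  convert! h8 using 2
  ring

/-! ### Competitive ratios and their limit -/

theorem algValue_nonneg {p : unitInterval} {ζ : ℝ} (hζ : 0 ≤ ζ) (A : AdaptiveAlgorithm) (n : ℕ)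
    (F : ValueLaw) : 0 ≤ algValue p ζ A n F :=
  integral_nonneg fun τ => thresholdValue_nonneg hζ F τ

/-- Averaging over random thresholds cannot beat a bound valid for each realisation. Nonnegativity
suffices: a non-integrable value would have Bochner integral 0, still below B. -/
theorem algValue_le {p : unitInterval} {ζ : ℝ} (hζ : 0 ≤ ζ) (A : AdaptiveAlgorithm) {n : ℕ}
    {F : ValueLaw} {B : ℝ} (h : ∀ τ : Fin n → ℝ, thresholdValue p ζ F τ ≤ B) :
    algValue p ζ A n F ≤ B := by
  have := A.isProbabilityMeasure n F
  calc algValue p ζ A n F ≤ ∫ _, B ∂(A.thresholds n F) :=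
        integral_mono_of_nonneg (Eventually.of_forall fun τ => thresholdValue_nonneg hζ F τ)
          (integrable_const B) (Eventually.of_forall h)
    _ = B := by simp

/-- The adaptive threshold algorithm with deterministic thresholds `τ`. -/
noncomputable def AdaptiveAlgorithm.ofThresholds (τ : (n : ℕ) → ValueLaw → Fin n → ℝ)
    (h : ∀ n F, Antitone (τ n F)) : AdaptiveAlgorithm where
  thresholds n F := Measure.dirac (τ n F)
  isProbabilityMeasure _ _ := inferInstance
  antitone n F := by
    rw [ae_dirac_eq]
    exact h n F

instance : Nonempty AdaptiveAlgorithm :=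
  ⟨AdaptiveAlgorithm.ofThresholds (fun _ _ _ => 0) fun _ _ => antitone_const⟩

theorem algValue_ofThresholds (p : unitInterval) (ζ : ℝ) (τ : (n : ℕ) → ValueLaw → Fin n → ℝ)
    (h : ∀ n F, Antitone (τ n F)) (n : ℕ) (F : ValueLaw) :
    algValue p ζ (AdaptiveAlgorithm.ofThresholds τ h) n F = thresholdValue p ζ F (τ n F) :=
  integral_dirac _ _

/-- The hard law is fixed before the algorithm, so one and the same instance bounds `gammaLength`
and, as a single pair (n, F), also `gammaAD`. -/
theorem exists_ratio_le {c : ℝ} (hc : 0 < c) (h1 : hillKertzTime c 1 = 1) {n : ℕ} (hn : n ≠ 0)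
    {p : unitInterval} (hp : 0 < p) (hp1 : p < 1) {ζ : ℝ} (hζ : 0 ≤ ζ) (hζ1 : ζ ≤ 1)
    (hpos : 0 < hardOptBound c p n) :
    ∃ F : ValueLaw, ∀ A : AdaptiveAlgorithm, algValue p ζ A n F / optValue p ζ n F ≤
      (hillKertzValue c 1 + c⁻¹ * (n : ℝ)⁻¹) / hardOptBound c p n := by
  obtain ⟨F, hopt, halg⟩ := exists_hard_instance hc h1 hn hp hp1 hζ hζ1
  have hp' : (0 : ℝ) < p := hp
  have hk : 0 < payFraction p ζ / p := div_pos (payFraction_pos hp1 hζ) hp'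
  refine ⟨F, fun A => ?_⟩
  have hA := algValue_le hζ A halg
  rw [← mul_div_mul_left _ (hardOptBound c p n) hk.ne']
  exact div_le_div₀ ((algValue_nonneg hζ A n F).trans hA) hA (mul_pos hk hpos) hopt

theorem ratio_nonneg {p : unitInterval} (hp : 0 < p) (hp1 : p < 1) {ζ : ℝ} (hζ : 0 ≤ ζ)
    (hζ1 : ζ ≤ 1) {n : ℕ} (hn : n ≠ 0) (A : AdaptiveAlgorithm) (F : ValueLaw) :
    0 ≤ algValue p ζ A n F / optValue p ζ n F :=
  div_nonneg (algValue_nonneg hζ A n F) (optValue_pos hp hp1 hζ hζ1 hn F).le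

theorem iInf_ratio_le {c : ℝ} (hc : 0 < c) (h1 : hillKertzTime c 1 = 1) {n : ℕ} (hn : n ≠ 0)
    {p : unitInterval} (hp : 0 < p) (hp1 : p < 1) {ζ : ℝ} (hζ : 0 ≤ ζ) (hζ1 : ζ ≤ 1)
    (hpos : 0 < hardOptBound c p n) (A : AdaptiveAlgorithm) :
    ⨅ F : ValueLaw, algValue p ζ A n F / optValue p ζ n F ≤
      (hillKertzValue c 1 + c⁻¹ * (n : ℝ)⁻¹) / hardOptBound c p n := by
  obtain ⟨F, hF⟩ := exists_ratio_le hc h1 hn hp hp1 hζ hζ1 hpos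
  refine (ciInf_le ⟨0, ?_⟩ F).trans (hF A)
  rintro _ ⟨F, rfl⟩
  exact ratio_nonneg hp hp1 hζ hζ1 hn A F

theorem gammaAD_le {c : ℝ} (hc : 0 < c) (h1 : hillKertzTime c 1 = 1) {n : ℕ} (hn : n ≠ 0)
    {p : unitInterval} (hp : 0 < p) (hp1 : p < 1) {ζ : ℝ} (hζ : 0 ≤ ζ) (hζ1 : ζ ≤ 1)
    (hpos : 0 < hardOptBound c p n) :
    gammaAD p ζ ≤ (hillKertzValue c 1 + c⁻¹ * (n : ℝ)⁻¹) / hardOptBound c p n := by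
  obtain ⟨F, hF⟩ := exists_ratio_le hc h1 hn hp hp1 hζ hζ1 hpos
  refine ciSup_le fun A => (ciInf_le (f := fun I : ℕ+ × ValueLaw =>
    algValue p ζ A (I.1 : ℕ) I.2 / optValue p ζ (I.1 : ℕ) I.2) ⟨0, ?_⟩
    (⟨n, Nat.pos_of_ne_zero hn⟩, F)).trans (hF A)
  rintro _ ⟨I, rfl⟩
  exact ratio_nonneg hp hp1 hζ hζ1 I.1.ne_zero A I.2

theorem le_gammaLength {c : ℝ} (hc : 0 < c) (h1 : hillKertzTime c 1 = 1) {n : ℕ} (hn : n ≠ 0)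
    {p : unitInterval} (hp : 0 < p) (hp1 : p < 1) {ζ : ℝ} (hζ : 0 ≤ ζ) (hζ1 : ζ ≤ 1)
    (hpos : 0 < hardOptBound c p n) {K : ℝ} (hK : 0 < K)
    (hKp : 1 - Real.exp (-(K / n)) ≤ p) :
    (1 + c)⁻¹ * Real.exp (-(2 * K / n)) * (1 - Real.exp (-K)) ≤ gammaLength n p ζ := by
  classical
  obtain ⟨u, hu, hu0, hu1, hρ⟩ := exists_acceptance_probabilities hc h1 hn hK
  set ρ := (1 + c)⁻¹ * Real.exp (-(2 * K / n)) * (1 - Real.exp (-K))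
  have hthr := exists_thresholds_ge hp hζ hζ1 hu hu0 (fun i => (hu1 i).trans hKp)
    fun s hs0 hsp => hρ s hs0 (hsp.trans_lt hp1)
  -- The algorithm must be defined on all lengths; the zero thresholds are a default, and only
  -- length n matters here.
  let τ : (m : ℕ) → ValueLaw → Fin m → ℝ := fun m F =>
    if h : ∃ τ : Fin m → ℝ, Antitone τ ∧ ρ * optValue p ζ m F ≤ thresholdValue p ζ F τ
    then h.choose else fun _ => 0
  have hτ : ∀ m F, Antitone (τ m F) := by
    intro m F
    simp only [τ]
    split_ifs with h
    · exact h.choose_spec.1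
    · exact antitone_const
  have hne : Nonempty ValueLaw := ⟨(exists_ratio_le hc h1 hn hp hp1 hζ hζ1 hpos).choose⟩
  refine le_ciSup_of_le ⟨(hillKertzValue c 1 + c⁻¹ * (n : ℝ)⁻¹) / hardOptBound c p n, ?_⟩
    (AdaptiveAlgorithm.ofThresholds τ hτ) (le_ciInf fun F => ?_)
  · rintro _ ⟨A, rfl⟩
    exact iInf_ratio_le hc h1 hn hp hp1 hζ hζ1 hpos A
  · rw [algValue_ofThresholds, le_div_iff₀ (optValue_pos hp hp1 hζ hζ1 hn F)]
    simp only [τ, dif_pos (hthr F)]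
    exact (hthr F).choose_spec.2

theorem hillKertzValue_one_pos {c : ℝ} (hc : 0 < c) : 0 < hillKertzValue c 1 := by
  rw [← hillKertzValue_zero c]
  exact hillKertzValue_strictMono hc one_pos

theorem tendsto_upper_bound {c : ℝ} (hc : 0 < c) {p : ℝ} (hp : 0 < p) :
    Tendsto (fun n : ℕ => (hillKertzValue c 1 + c⁻¹ * (n : ℝ)⁻¹) / hardOptBound c p n) atTop
      (𝓝 (1 + c)⁻¹) := by
  have hv := hillKertzValue_one_pos hc
  have h1 : Tendsto (fun n : ℕ => hillKertzValue c 1 + c⁻¹ * (n : ℝ)⁻¹) atTop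
      (𝓝 (hillKertzValue c 1 + c⁻¹ * 0)) :=
    tendsto_const_nhds.add
      ((tendsto_inv_atTop_zero.comp (tendsto_natCast_atTop_atTop (R := ℝ))).const_mul _)
  have h2 := h1.div (tendsto_hardOptBound hc hp) (by positivity)
  convert! h2 using 2
  field_simp
  ring

theorem tendsto_gammaLength {c : ℝ} (hc : 0 < c) (h1 : hillKertzTime c 1 = 1)
    {p : unitInterval} (hp : 0 < p) (hp1 : p < 1) {ζ : ℝ} (hζ : 0 ≤ ζ) (hζ1 : ζ ≤ 1) :
    Tendsto (fun n : ℕ => gammaLength n p ζ) atTop (𝓝 (1 + c)⁻¹) := by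
  have hp' : (0 : ℝ) < p := hp
  have hθ : 0 < (1 + c)⁻¹ := by positivity
  have hpos : ∀ᶠ n in atTop, 0 < hardOptBound c p n :=
    (tendsto_hardOptBound hc hp').eventually_const_lt
      (mul_pos (by linarith) (hillKertzValue_one_pos hc))
  refine tendsto_order.2 ⟨fun a ha => ?_, fun a ha => ?_⟩
  -- K is fixed first, to bring θ(1 - e^{-K}) above a. Then n is taken large, so that e^{-2K/n}
  -- costs little and the stopping probabilities, at most 1 - e^{-K/n}, stay below p.
  · have hK : Tendsto (fun K : ℝ => (1 + c)⁻¹ * (1 - Real.exp (-K))) atTop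
        (𝓝 ((1 + c)⁻¹ * (1 - 0))) :=
      (tendsto_const_nhds.sub Real.tendsto_exp_neg_atTop_nhds_zero).const_mul _
    obtain ⟨K, haK, hK0⟩ := ((hK.eventually_const_lt (by simpa using ha)).and
      (eventually_gt_atTop 0)).exists
    have hdiv : ∀ L : ℝ, Tendsto (fun n : ℕ => Real.exp (-(L / n))) atTop (𝓝 1) := by
      intro L
      have h2 := (Real.continuous_exp.tendsto _).comp
        (tendsto_const_div_atTop_nhds_zero_nat L).neg
      rwa [neg_zero, Real.exp_zero] at h2
    have h3 : Tendsto (fun n : ℕ => (1 + c)⁻¹ * Real.exp (-(2 * K / n)) * (1 - Real.exp (-K)))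
        atTop (𝓝 ((1 + c)⁻¹ * 1 * (1 - Real.exp (-K)))) :=
      ((hdiv (2 * K)).const_mul _).mul_const _
    have h4 : Tendsto (fun n : ℕ => 1 - Real.exp (-(K / n))) atTop (𝓝 (1 - 1)) :=
      (hdiv K).const_sub 1
    filter_upwards [hpos, eventually_ne_atTop 0, h3.eventually_const_lt (by simpa using haK),
      h4.eventually_le_const (show (1 : ℝ) - 1 < p by rwa [sub_self])] with n hn hn0 h5 h6
    exact h5.trans_le (le_gammaLength hc h1 hn0 hp hp1 hζ hζ1 hn hK0 h6)
  · filter_upwards [hpos, eventually_ne_atTop 0,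
      (tendsto_upper_bound hc hp').eventually_lt_const ha] with n hn hn0 h2
    exact (ciSup_le fun A => iInf_ratio_le hc h1 hn0 hp hp1 hζ hζ1 hn A).trans_lt h2

theorem gammaAD_le_hillKertz {c : ℝ} (hc : 0 < c) (h1 : hillKertzTime c 1 = 1)
    {p : unitInterval} (hp : 0 < p) (hp1 : p < 1) {ζ : ℝ} (hζ : 0 ≤ ζ) (hζ1 : ζ ≤ 1) :
    gammaAD p ζ ≤ (1 + c)⁻¹ := by
  have hp' : (0 : ℝ) < p := hp
  refine ge_of_tendsto (tendsto_upper_bound hc hp') ?_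
  filter_upwards [(tendsto_hardOptBound hc hp').eventually_const_lt
    (mul_pos (by linarith) (hillKertzValue_one_pos hc)), eventually_ne_atTop 0] with n hn hn0
  exact gammaAD_le hc h1 hn0 hp hp1 hζ hζ1 hn

theorem theorem3 :
    (∃! θ : ℝ, IsHillKertzConstant θ) ∧
    ∀ θ : ℝ, IsHillKertzConstant θ →
      ∀ (p : unitInterval) (ζ : ℝ), 0 < p → p < 1 → 0 ≤ ζ → ζ ≤ 1 →
        gammaAD p ζ ≤ θ ∧
        Tendsto (fun n : ℕ => gammaLength n p ζ) atTop (𝓝 θ) := by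
  refine ⟨existsUnique_hillKertzConstant, fun θ hθ p ζ hp hp1 hζ hζ1 => ?_⟩
  obtain ⟨c, hc, rfl, h1⟩ := (isHillKertzConstant_iff θ).1 hθ
  exact ⟨gammaAD_le_hillKertz hc h1 hp hp1 hζ hζ1, tendsto_gammaLength hc h1 hp hp1 hζ hζ1⟩
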